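/- Let $k$ be a field, $K/k$ a field extension and $A$ a central simple $K$-algebra of degree $n$, i.e. $\dim_K A=n^2$. For an intermediate field $k\subseteq K_0\subseteq K$, say that $A$ descends to $K_0$ if $A\cong A_0\otimes_{K_0}K$ as $K$-algebras for some central simple $K_0$-algebra $A_0$; let $\operatorname{ed}(A)$ be the minimal transcendence degree over $k$ of an intermediate field to which $A$ descends. (a) Suppose that $A$ contains a field $F\supseteq K$ that is Galois over $K$ and that $\operatorname{Gal}(F/K)$ can be generated by $r\ge 1$ elements; if $[F:K]=n$, assume moreover that $r\ge 2$. Then $$\operatorname{ed}(A)\le r\,\frac{n^2}{[F:K]}-n+1 .$$ (b) Let $H\le G$ be groups with $\bigcap_{g\in G}gHg^{-1}=\{1\}$, and suppose that $A$ is a $G/H$-crossed product, i.e. there are a finite Galois extension $E/K$ with $\operatorname{Gal}(E/K)\cong G$ and an intermediate field $L$ of $E/K$ such that $\operatorname{Gal}(E/L)$ corresponds to $H$, $[L:K]=n$, and $L$ embeds in $A$ over $K$. Suppose that $H\le N\trianglelefteq G$, that $G/N$ can be generated by $r\ge 1$ elements, and that $H\ne\{1\}$ or $r\ge 2$. Then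 $$\operatorname{ed}(A)\le r\,[G:H]\,[N:H]-[G:H]+1 .$$ -/

import Mathlib

open Module TensorProduct

universe u v w

/-- `A` is a central simple algebra over the field `K`: a finite-dimensional simple `K`-algebra
with centre `K`. -/
class IsCSA (K : Type u) (A : Type v) [Field K] [Ring A] [Algebra K A] : Prop where
  central : Algebra.IsCentral K A
  simple : IsSimpleRing A
  finite : FiniteDimensional K A

/-- The central simple `K`-algebra `A` descends to the intermediate field `k ⊆ K₀ ⊆ K`:
`A ≅ K ⊗_{K₀} A₀` as `K`-algebras for some central simple `K₀`-algebra `A₀`.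
Such an `A₀` embeds in `A`, so it can be taken in the universe of `A`. -/
def DescendsTo {k : Type w} {K : Type u} [Field k] [Field K] [Algebra k K]
    (A : Type v) [Ring A] [Algebra K A] (K₀ : IntermediateField k K) : Prop :=
  ∃ (A₀ : Type v) (_ : Ring A₀) (_ : Algebra K₀ A₀),
    IsCSA K₀ A₀ ∧ Nonempty (K ⊗[K₀] A₀ ≃ₐ[K] A)

/-- The essential dimension of `A/K` over the base field `k`: the least transcendence degree
over `k` of an intermediate field to which `A` descends. (Cardinals are well-ordered and `A`
descends to `K` itself, so the infimum is a minimum.) -/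
noncomputable def essentialDim (k : Type w) (K : Type u) [Field k] [Field K] [Algebra k K]
    (A : Type v) [Ring A] [Algebra K A] : Cardinal.{u} :=
  sInf {c | ∃ K₀ : IntermediateField k K, DescendsTo A K₀ ∧ Algebra.trdeg k K₀ = c}

/-- The group `G` can be generated by `r` elements (repetitions allowed). -/
def GeneratedBy (G : Type*) [Group G] (r : ℕ) : Prop :=
  ∃ g : Fin r → G, Subgroup.closure (Set.range g) = ⊤

/-- The central simple algebra `A/K` is a `G/H`-crossed product: there are a finite Galois
extension `E/K` with an identification `Gal(E/K) ≅ G` and an intermediate field `L` of `E/K` with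
`Gal(E/L)` corresponding to `H`, such that `L` embeds in `A` over `K` and `[L : K]` is the degree
of `A`. Triviality of the core of `H` in `G` says that `E` is the Galois closure of `L/K`. -/
def IsCrossedProduct {G : Type*} [Group G] (H : Subgroup G)
    (K : Type u) [Field K] (A : Type v) [Ring A] [Algebra K A] : Prop :=
  IsCSA K A ∧ H.normalCore = ⊥ ∧
    ∃ (E : Type u) (_ : Field E) (_ : Algebra K E) (e : (E ≃ₐ[K] E) ≃* G)
      (L : IntermediateField K E),
      FiniteDimensional K E ∧ IsGalois K E ∧
      L.fixingSubgroup.map e.toMonoidHom = H ∧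
      finrank K A = finrank K L ^ 2 ∧ Nonempty (L →ₐ[K] A)

/-! Write Ω for an algebraic closure of K and embed A in the n × n matrices over Ω so that its image
spans. If Ω₀ ⊆ Ω contains all entries of enough elements of A that these span the matrix algebra
over Ω, then A descends to K ∩ Ω₀ (`descendsTo_comap`), whose transcendence degree is at most that
of Ω₀. So the task is to find elements of A that yield a spanning set and have few independent
matrix entries.

Choose the splitting so that F is diagonal (`exists_adapted_splitting`). Each index x then carries
an element π x of Gal(F/K), and every fibre of π has m = n/[F:K] points (`card_fiber_mul_finrank`).
For g in Gal(F/K), the elements a of A with a f = g(f) a for all f in F are those whose matrices are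
supported where π y = π x * g. For generators g₁, …, g_r take one such element each, in general
position; this requires K infinite. Together they have r n m possibly nonzero entries. Their support
digraph is strongly connected, so it contains a spanning tree directed to a root, and conjugation by
a diagonal matrix turns the n − 1 entries on the tree into 1. Adjoining the remaining r n m − n + 1
entries to k gives Ω₀.

For the spanning, the diagonal part of an element of A again lies in A, because it arises from a
polynomial in ad θ for some θ in A that is diagonal with distinct entries. If the diagonals of words
in the chosen elements separate the indices, they yield all diagonal idempotents, and strong
connectedness yields all matrix units. Closed walks in the digraph provide separating words: one
generator is enough if m > 1 (`exists_separating_power`), two are used if m = 1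
(`exists_separating_word`); hence the assumption r ≥ 2 when [F:K] = n.

Part (b) is part (a) for F = E^N. Over a finite K the essential dimension is 0. -/

/-! ### Central simple algebras are split by an algebraic closure -/

/-- The subalgebra of `End_K A` generated by left and right multiplications. -/
def multAlgebra (K : Type*) (A : Type*) [Field K] [Ring A] [Algebra K A] :
    Subalgebra K (Module.End K A) :=
  Algebra.adjoin K (Set.range (LinearMap.mulLeft K) ∪ Set.range (LinearMap.mulRight K))

theorem mulLeft_mem_multAlgebra (K : Type*) {A : Type*} [Field K] [Ring A] [Algebra K A] (a : A) :
    LinearMap.mulLeft K a ∈ multAlgebra K A :=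
  Algebra.subset_adjoin (Or.inl ⟨a, rfl⟩)

theorem mulRight_mem_multAlgebra (K : Type*) {A : Type*} [Field K] [Ring A] [Algebra K A] (a : A) :
    LinearMap.mulRight K a ∈ multAlgebra K A :=
  Algebra.subset_adjoin (Or.inr ⟨a, rfl⟩)

/-- Submodules over the multiplication algebra are two-sided ideals. -/
theorem isSimpleModule_multAlgebra (K : Type*) (A : Type*) [Field K] [Ring A] [Algebra K A]
    [IsSimpleRing A] : IsSimpleModule (multAlgebra K A) A := by
  rw [isSimpleModule_iff]
  refine { exists_pair_ne := ⟨⊥, ⊤, bot_ne_top⟩, eq_bot_or_eq_top := fun N => ?_ }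
  by_cases hN : N = ⊥
  · exact Or.inl hN
  right
  obtain ⟨z, hz, hz0⟩ := N.ne_bot_iff.1 hN
  have hl : ∀ a x : A, x ∈ N → a * x ∈ N := fun a x hx =>
    N.smul_mem ⟨_, mulLeft_mem_multAlgebra K a⟩ hx
  have hr : ∀ a x : A, x ∈ N → x * a ∈ N := fun a x hx =>
    N.smul_mem ⟨_, mulRight_mem_multAlgebra K a⟩ hx
  let I : TwoSidedIdeal A := TwoSidedIdeal.mk' (N : Set A) N.zero_mem (fun h h' => N.add_mem h h')
    (fun {x} h => (by simpa using hl (-1) x h)) (fun {x y} h => hl x y h) (fun {x y} h => hr y x h)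
  have hI : (1 : A) ∈ I := IsSimpleRing.one_mem_of_ne_zero_mem (x := z) I hz0 (by
    simpa [I, TwoSidedIdeal.mem_mk'] using hz)
  have h1 : (1 : A) ∈ N := by simpa [I, TwoSidedIdeal.mem_mk'] using hI
  rw [eq_top_iff]
  intro a _
  simpa using hl a 1 h1

/-- Jacobson density: an endomorphism of A commuting with all left and right multiplications is
multiplication by a central element, hence by a scalar, so every K-linear map lies in the double
commutant. -/
theorem mem_multAlgebra (K : Type*) (A : Type*) [Field K] [Ring A] [Algebra K A]
    [IsSimpleRing A] [Algebra.IsCentral K A] [FiniteDimensional K A] (g : Module.End K A) :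
    g ∈ multAlgebra K A := by
  classical
  have := isSimpleModule_multAlgebra K A
  have hcomm : ∀ f : Module.End (multAlgebra K A) A, ∃ c : K, ∀ a, f a = c • a := by
    intro f
    have hl : ∀ a, f a = a * f 1 := fun a => by
      have := f.map_smul ⟨_, mulLeft_mem_multAlgebra K a⟩ (1 : A)
      simpa [Subalgebra.smul_def] using this
    have hr : ∀ a, f a = f 1 * a := fun a => by
      have := f.map_smul ⟨_, mulRight_mem_multAlgebra K a⟩ (1 : A)
      simpa [Subalgebra.smul_def] using this
    have hc : f 1 ∈ Subalgebra.center K A :=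
      Subalgebra.mem_center_iff.2 fun b => by rw [← hl, ← hr]
    rw [Algebra.IsCentral.center_eq_bot, Algebra.mem_bot] at hc
    obtain ⟨c, hc⟩ := hc
    exact ⟨c, fun a => by rw [hr, ← hc, Algebra.smul_def]⟩
  let g' : Module.End (Module.End (multAlgebra K A) A) A :=
    { toFun := g
      map_add' := g.map_add
      map_smul' := fun f a => by
        obtain ⟨c, hc⟩ := hcomm f
        simp [hc] }
  let b := Module.finBasis K A
  obtain ⟨p, hp⟩ := jacobson_density (R := multAlgebra K A) (M := A) g' (Finset.univ.image b)
  have : g = p := b.ext fun i => hp (b i) (by simp)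
  rw [this]
  exact p.2

/-- An ideal of Ω ⊗ A is stable under the base change of every multiplication, hence of every
K-endomorphism of A. A coordinate projection turns a nonzero element of the ideal into c ⊗ 1 with c
≠ 0, which is a unit. -/
theorem isSimpleRing_tensorProduct (K Ω : Type*) (A : Type*) [Field K] [Field Ω] [Algebra K Ω]
    [Ring A] [Algebra K A] [IsSimpleRing A] [Algebra.IsCentral K A] [FiniteDimensional K A] :
    IsSimpleRing (Ω ⊗[K] A) := by
  refine IsSimpleRing.of_eq_bot_or_eq_top fun I => ?_
  by_cases hI : I = ⊥
  · exact Or.inl hI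
  right
  obtain ⟨z, hz, hz0⟩ : ∃ z ∈ I, z ≠ 0 := by
    by_contra! h
    exact hI (le_antisymm (fun z hz => by simpa using h z hz) bot_le)
  have key : ∀ p ∈ multAlgebra K A, ∀ z ∈ I, LinearMap.baseChange Ω p z ∈ I := by
    intro p hp
    induction hp using Algebra.adjoin_induction with
    | mem p hp =>
      intro z hz
      rcases hp with ⟨a, rfl⟩ | ⟨a, rfl⟩
      · have : LinearMap.baseChange Ω (LinearMap.mulLeft K a)
            = LinearMap.mulLeft Ω ((1 : Ω) ⊗ₜ[K] a) :=
          TensorProduct.AlgebraTensorModule.ext fun x y => by simp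
        rw [this]
        exact I.mul_mem_left _ _ hz
      · have : LinearMap.baseChange Ω (LinearMap.mulRight K a)
            = LinearMap.mulRight Ω ((1 : Ω) ⊗ₜ[K] a) :=
          TensorProduct.AlgebraTensorModule.ext fun x y => by simp
        rw [this]
        exact I.mul_mem_right _ _ hz
    | algebraMap c =>
      intro z hz
      have : LinearMap.baseChange Ω (algebraMap K (Module.End K A) c)
          = LinearMap.mulLeft Ω ((1 : Ω) ⊗ₜ[K] algebraMap K A c) :=
        TensorProduct.AlgebraTensorModule.ext fun x y => by simp [Algebra.smul_def]
      rw [this]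
      exact I.mul_mem_left _ _ hz
    | add p q _ _ hp hq =>
      intro z hz
      rw [LinearMap.baseChange_add]
      exact I.add_mem (hp z hz) (hq z hz)
    | mul p q _ _ hp hq =>
      intro z hz
      rw [LinearMap.baseChange_mul]
      exact hp _ (hq z hz)
  let b := Module.finBasis K A
  obtain ⟨j, hj⟩ : ∃ j, (b.baseChange Ω).repr z j ≠ 0 := by
    by_contra! h
    exact hz0 ((b.baseChange Ω).repr.map_eq_zero_iff.1 (Finsupp.ext h))
  let g : Module.End K A := (b.coord j).smulRight 1
  have hg : LinearMap.baseChange Ω g z = ((b.baseChange Ω).repr z j) ⊗ₜ 1 := by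
    have : LinearMap.baseChange Ω g
        = ((b.baseChange Ω).coord j).smulRight ((1 : Ω) ⊗ₜ[K] (1 : A)) :=
      TensorProduct.AlgebraTensorModule.ext fun x y => by
        simp only [g, LinearMap.smulRight_apply, Basis.coord_apply, LinearMap.baseChange_tmul,
          Basis.baseChange_repr_tmul, TensorProduct.smul_tmul', smul_eq_mul, mul_one]
        rw [TensorProduct.smul_tmul]
    rw [this]
    simp [TensorProduct.smul_tmul']
  have h1 := key g (mem_multAlgebra K A g) z hz
  rw [hg] at h1
  have h2 := I.mul_mem_left (((b.baseChange Ω).repr z j)⁻¹ ⊗ₜ 1) _ h1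
  rw [Algebra.TensorProduct.tmul_mul_tmul, inv_mul_cancel₀ hj, one_mul] at h2
  rw [eq_top_iff]
  intro x _
  rw [← mul_one x, Algebra.TensorProduct.one_def]
  exact I.mul_mem_left x _ h2

theorem exists_splitting (K Ω : Type*) (A : Type*) [Field K] [Field Ω] [Algebra K Ω] [IsAlgClosed Ω]
    [Ring A] [Algebra K A] [IsSimpleRing A] [Algebra.IsCentral K A] [FiniteDimensional K A] :
    ∃ (n : ℕ) (_ : NeZero n) (ρ : A →ₐ[K] Matrix (Fin n) (Fin n) Ω),
      finrank K A = n ^ 2 ∧ Submodule.span Ω (Set.range ρ) = ⊤ := by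
  have := isSimpleRing_tensorProduct K Ω A
  obtain ⟨n, hn, ⟨e⟩⟩ := IsSimpleRing.exists_algEquiv_matrix_of_isAlgClosed Ω (Ω ⊗[K] A)
  refine ⟨n, hn, (e.restrictScalars K).toAlgHom.comp Algebra.TensorProduct.includeRight, ?_, ?_⟩
  · have := e.toLinearEquiv.finrank_eq
    rw [Module.finrank_baseChange, Module.finrank_matrix] at this
    rw [this]; simp [sq]
  · have h : (Submodule.span Ω (Set.range fun a : A => (1 : Ω) ⊗ₜ[K] a)) = ⊤ := by
      rw [eq_top_iff]
      intro z _
      induction z with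
      | zero => exact Submodule.zero_mem _
      | add x y hx hy => exact Submodule.add_mem _ (hx trivial) (hy trivial)
      | tmul x y =>
        rw [← mul_one x, ← smul_eq_mul, ← TensorProduct.smul_tmul']
        exact Submodule.smul_mem _ _ (Submodule.subset_span ⟨y, rfl⟩)
    have h' := congrArg (Submodule.map e.toLinearMap) h
    rw [Submodule.map_span, Submodule.map_top, LinearMap.range_eq_top.2 e.surjective,
      ← Set.range_comp] at h'
    exact h'

/-! ### Descent along a subfield of the splitting field -/

section Descent

variable {k : Type w} {K : Type u} {Ω : Type*} [Field k] [Field K] [Field Ω] [Algebra k K]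
  [Algebra K Ω] [Algebra k Ω] [IsScalarTower k K Ω] {A : Type v} [Ring A] [Algebra K A]
  {X : Type*} [Fintype X]

/-- The elements of `A` represented by matrices with entries in `Ω₀`, as an algebra over
`K ∩ Ω₀`. -/
def entrySubalgebra [DecidableEq X] (ρ : A →ₐ[K] Matrix X X Ω) (Ω₀ : IntermediateField k Ω) :
    Subalgebra (Ω₀.comap (IsScalarTower.toAlgHom k K Ω)) A where
  carrier := {a | ∀ x y, ρ a x y ∈ Ω₀}
  mul_mem' := fun {a b} ha hb x y => by
    rw [map_mul, Matrix.mul_apply]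
    exact sum_mem fun z _ => mul_mem (ha x z) (hb z y)
  add_mem' := fun {a b} ha hb x y => by
    rw [map_add]
    exact add_mem (ha x y) (hb x y)
  algebraMap_mem' := fun c x y => by
    have : ρ (algebraMap _ A c) = algebraMap K _ (c : K) := ρ.commutes (c : K)
    rw [this, Matrix.algebraMap_matrix_apply]
    split_ifs
    · exact c.2
    · exact zero_mem _

/-- A subset of `A` whose image spans the matrix algebra contains a basis of `A` that stays
independent over `Ω`. -/
theorem exists_basis_mem_of_span_image_eq_top [DecidableEq X] [FiniteDimensional K A]
    (ρ : A →ₐ[K] Matrix X X Ω) (hcard : finrank K A = Fintype.card X ^ 2) (S : Set A)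
    (h : Submodule.span Ω (ρ '' S) = ⊤) :
    ∃ b : Basis (X × X) K A, (∀ i, b i ∈ S) ∧ LinearIndependent Ω fun i => ρ (b i) := by
  classical
  obtain ⟨t, htS, hspan, hli⟩ := exists_linearIndependent K S
  have hspan' : Submodule.span Ω (ρ '' t) = ⊤ := by
    rw [eq_top_iff, ← h, Submodule.span_le]
    rintro _ ⟨a, ha, rfl⟩
    have hle : Submodule.span K t
        ≤ ((Submodule.span Ω (ρ '' t)).restrictScalars K).comap ρ.toLinearMap :=
      Submodule.span_le.2 fun x hx => Submodule.subset_span ⟨x, hx, rfl⟩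
    exact hle (hspan ▸ Submodule.subset_span ha)
  have htfin : t.Finite := hli.setFinite
  have : Fintype t := htfin.fintype
  have hle : Fintype.card t ≤ finrank K A := hli.fintype_card_le_finrank
  -- Independence over K bounds the size of t above by |X|², spanning over Ω bounds it below; so t
  -- is a basis on both sides.
  have hge : Fintype.card X ^ 2 ≤ Fintype.card t := by
    have := finrank_range_le_card (R := Ω) (fun i : t => ρ i)
    have hr : (Set.range fun i : t => ρ i) = ρ '' t := by
      rw [← Function.comp_def, Set.range_comp, Subtype.range_coe]
    rw [hr, Set.finrank, hspan', finrank_top,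
      Module.finrank_matrix, finrank_self, mul_one, ← sq] at this
    exact this
  have hc : Fintype.card t = Fintype.card (X × X) := by
    rw [Fintype.card_prod, ← sq]; omega
  let e := Fintype.equivOfCardEq hc
  let b0 : Basis t K A := basisOfLinearIndependentOfCardEqFinrank' _ hli (by omega)
  refine ⟨b0.reindex e, fun i => ?_, ?_⟩
  · simpa [b0] using htS (e.symm i).2
  · have : LinearIndependent Ω fun i : t => ρ i := by
      apply linearIndependent_of_top_le_span_of_card_eq_finrank
      · rw [← Function.comp_def, Set.range_comp, Subtype.range_coe, hspan']
      · rw [hc, Module.finrank_matrix, finrank_self, mul_one, Fintype.card_prod]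
    have h2 := this.comp e.symm e.symm.injective
    convert h2 using 2 with i
    simp [b0]

/-- The w i form, by counting, a basis of the matrices over Ω₀. Coordinates over Ω₀ exist, and they
are the coordinates over Ω by uniqueness. -/
theorem mem_of_sum_smul_mem {Ω₀ : IntermediateField k Ω} (w : X × X → Matrix X X Ω)
    (hw : LinearIndependent Ω w) (hmem : ∀ i x y, w i x y ∈ Ω₀) (c : X × X → Ω)
    (hc : ∀ x y, (∑ i, c i • w i) x y ∈ Ω₀) (i : X × X) : c i ∈ Ω₀ := by
  classical
  let w' : X × X → Matrix X X Ω₀ := fun i => Matrix.of fun x y => ⟨w i x y, hmem i x y⟩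
  have hmap : ∀ d : X × X → Ω₀, (∑ i, d i • w' i).map (algebraMap Ω₀ Ω)
      = ∑ i, (d i : Ω) • w i := by
    intro d
    ext x y
    simp [Matrix.sum_apply, w']
  have hli : LinearIndependent Ω₀ w' := by
    rw [Fintype.linearIndependent_iff] at hw ⊢
    intro d hd i
    have := hw (fun i => d i) (by rw [← hmap, hd]; ext; simp) i
    exact_mod_cast this
  have hspan := hli.span_eq_top_of_card_eq_finrank' (by
    rw [Module.finrank_matrix, finrank_self, mul_one, Fintype.card_prod])
  let m : Matrix X X Ω₀ := Matrix.of fun x y => ⟨_, hc x y⟩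
  have hm : m ∈ Submodule.span Ω₀ (Set.range w') := hspan ▸ Submodule.mem_top
  obtain ⟨d, hd⟩ := (Submodule.mem_span_range_iff_exists_fun _).1 hm
  have h1 : ∑ i, (d i : Ω) • w i = ∑ i, c i • w i := by
    rw [← hmap, hd]; ext x y; simp [m]
  have h2 := Fintype.linearIndependent_iffₛ.1 hw _ _ h1 i
  rw [← h2]
  exact (d i).2

/-- The form of A is the algebra A₀ of elements with entries in Ω₀. A K-basis of A inside A₀ that
stays independent over Ω is a K₀-basis of A₀: the coordinates of an element of A₀ lie in K and, by
linear algebra over Ω₀, also in Ω₀. -/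
theorem descendsTo_comap [DecidableEq X] [IsCSA K A] (ρ : A →ₐ[K] Matrix X X Ω)
    (hcard : finrank K A = Fintype.card X ^ 2) (Ω₀ : IntermediateField k Ω)
    (h : Submodule.span Ω (ρ '' {a | ∀ x y, ρ a x y ∈ Ω₀}) = ⊤) :
    DescendsTo A (Ω₀.comap (IsScalarTower.toAlgHom k K Ω)) := by
  classical
  have : FiniteDimensional K A := IsCSA.finite
  have : IsSimpleRing A := IsCSA.simple K
  have : Algebra.IsCentral K A := IsCSA.central
  set K₀ := Ω₀.comap (IsScalarTower.toAlgHom k K Ω) with hK₀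
  set A₀ := entrySubalgebra ρ Ω₀
  have hK₀mem : ∀ c : K, c ∈ K₀ ↔ algebraMap K Ω c ∈ Ω₀ := fun c => Iff.rfl
  obtain ⟨b, hbS, hbli⟩ := exists_basis_mem_of_span_image_eq_top ρ hcard _ h
  have hrepr : ∀ a ∈ A₀, ∀ i, b.repr a i ∈ K₀ := by
    intro a ha i
    refine (hK₀mem _).2 (mem_of_sum_smul_mem (fun i => ρ (b i)) hbli (fun i => hbS i)
      (fun i => algebraMap K Ω (b.repr a i)) (fun x y => ?_) i)
    have h1 : ∑ i, (algebraMap K Ω (b.repr a i)) • ρ (b i) = ρ a := by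
      conv_rhs => rw [← b.sum_repr a]
      simp only [map_sum, map_smul, algebraMap_smul]
    rw [h1]
    exact ha x y
  have : Nonempty X := by
    by_contra hX
    rw [not_nonempty_iff] at hX
    have := finrank_pos (R := K) (M := A)
    simp [hcard] at this
  have hli0 : LinearIndependent K₀ fun i => (⟨b i, hbS i⟩ : A₀) := by
    have h1 : LinearIndependent K₀ b := b.linearIndependent.restrict_scalars (by
      intro x y hxy
      simpa [Algebra.smul_def] using hxy)
    exact LinearIndependent.of_comp A₀.val.toLinearMap h1
  let b₀ : Basis (X × X) K₀ A₀ := Basis.mk hli0 (by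
    rintro a -
    have : a = ∑ i, (⟨b.repr a i, hrepr a a.2 i⟩ : K₀) • (⟨b i, hbS i⟩ : A₀) := by
      apply Subtype.ext
      conv_lhs => rw [← b.sum_repr (a : A)]
      simp only [AddSubmonoidClass.coe_finsetSum]
      rfl
    rw [this]
    exact Submodule.sum_mem _ fun i _ => Submodule.smul_mem _ _ (Submodule.subset_span ⟨i, rfl⟩))
  have hb₀ : ∀ i, (b₀ i : A) = b i := fun i => by simp [b₀]
  refine ⟨A₀, inferInstance, inferInstance, ⟨⟨?_⟩, ?_, ?_⟩, ?_⟩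
  · intro z hz
    have hz' : (z : A) ∈ Subalgebra.center K A := by
      rw [Subalgebra.mem_center_iff] at hz ⊢
      intro a
      rw [← b.sum_repr a, Finset.sum_mul, Finset.mul_sum]
      refine Finset.sum_congr rfl fun i _ => ?_
      have := congrArg Subtype.val (hz (b₀ i))
      simp only [MulMemClass.coe_mul, hb₀] at this
      rw [smul_mul_assoc, mul_smul_comm, this]
    rw [Algebra.IsCentral.center_eq_bot, Algebra.mem_bot] at hz'
    obtain ⟨c, hc⟩ := hz'
    obtain ⟨x⟩ := this
    have hcK : c ∈ K₀ := by
      have := z.2 x x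
      rw [← hc, AlgHom.commutes, Matrix.algebraMap_matrix_apply, if_pos rfl] at this
      exact this
    exact Algebra.mem_bot.2 ⟨⟨c, hcK⟩, Subtype.ext hc⟩
  · refine IsSimpleRing.of_eq_bot_or_eq_top fun I => ?_
    by_cases hI : I = ⊥
    · exact Or.inl hI
    right
    obtain ⟨z, hz, hz0⟩ : ∃ z ∈ I, z ≠ 0 := by
      by_contra! h
      exact hI (le_antisymm (fun z hz => by simpa using h z hz) bot_le)
    by_contra hItop
    let IK : Submodule K₀ A₀ :=
      { carrier := I
        add_mem' := fun h h' => I.add_mem h h'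
        zero_mem' := I.zero_mem
        smul_mem' := fun c x hx => by
          rw [Algebra.smul_def]; exact I.mul_mem_left _ _ hx }
    have h1 : (1 : A₀) ∉ IK := fun h1 => hItop (by
      rw [eq_top_iff]
      intro x _
      simpa using I.mul_mem_left x _ h1)
    obtain ⟨f, hf1, hfI⟩ := Submodule.exists_le_ker_of_notMem h1
    -- A functional on A₀ that kills the proper ideal I but not 1 extends K-linearly to A and kills
    -- the ideal J of A spanned by I. Since A is simple, J contains 1, a contradiction.
    let f' : A →ₗ[K] K := b.constr K fun i => (f (b₀ i) : K)
    have hff' : ∀ a : A₀, f' a = f a := by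
      intro a
      have hconj : (f'.restrictScalars K₀).comp A₀.val.toLinearMap
          = (Algebra.linearMap K₀ K).comp f := b₀.ext fun i => by
        simp [f', hb₀]
      exact LinearMap.congr_fun hconj a
    let J : Submodule K A := Submodule.span K ((↑) '' (I : Set A₀))
    have hJ : ∀ a ∈ J, f' a = 0 := by
      intro a ha
      have : J ≤ LinearMap.ker f' := Submodule.span_le.2 (by
        rintro _ ⟨x, hx, rfl⟩
        simp only [SetLike.mem_coe, LinearMap.mem_ker, hff']
        have := hfI (show x ∈ IK from hx)
        rw [LinearMap.mem_ker] at this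
        simp [this])
      exact this ha
    have hJl : ∀ a x : A, x ∈ J → a * x ∈ J := by
      intro a x hx
      have hle : J ≤ J.comap (LinearMap.mulLeft K a) := Submodule.span_le.2 (by
        rintro _ ⟨y, hy, rfl⟩
        rw [SetLike.mem_coe, Submodule.mem_comap, LinearMap.mulLeft_apply, ← b.sum_repr a,
          Finset.sum_mul]
        refine Submodule.sum_mem _ fun i _ => ?_
        rw [smul_mul_assoc]
        exact Submodule.smul_mem _ _ (Submodule.subset_span
          ⟨b₀ i * y, I.mul_mem_left _ _ hy, by simp [hb₀]⟩))
      exact hle hx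
    have hJr : ∀ a x : A, x ∈ J → x * a ∈ J := by
      intro a x hx
      have hle : J ≤ J.comap (LinearMap.mulRight K a) := Submodule.span_le.2 (by
        rintro _ ⟨y, hy, rfl⟩
        rw [SetLike.mem_coe, Submodule.mem_comap, LinearMap.mulRight_apply, ← b.sum_repr a,
          Finset.mul_sum]
        refine Submodule.sum_mem _ fun i _ => ?_
        rw [mul_smul_comm]
        exact Submodule.smul_mem _ _ (Submodule.subset_span
          ⟨y * b₀ i, I.mul_mem_right _ _ hy, by simp [hb₀]⟩))
      exact hle hx
    let J' : TwoSidedIdeal A := TwoSidedIdeal.mk' (J : Set A) J.zero_mem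
      (fun h h' => J.add_mem h h') (fun {x} h => J.neg_mem h) (fun {x y} h => hJl x y h)
      (fun {x y} h => hJr y x h)
    have hJ1 : (1 : A) ∈ J' := IsSimpleRing.one_mem_of_ne_zero_mem (x := (z : A)) J'
      (by simpa using hz0) (by
        simp only [J', TwoSidedIdeal.mem_mk']
        exact Submodule.subset_span ⟨z, hz, rfl⟩)
    have h3 : f' 1 = 0 := hJ 1 (by simpa [J', TwoSidedIdeal.mem_mk'] using hJ1)
    have h4 := hff' 1
    rw [OneMemClass.coe_one, h3] at h4
    exact hf1 (by exact_mod_cast h4.symm)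
  · exact Module.Finite.of_basis b₀
  · have hcomm : ∀ c a, Commute (Algebra.ofId K A c) (A₀.val a) :=
      fun c a => Algebra.commutes c (a : A)
    let μ : K ⊗[K₀] A₀ →ₐ[K] A := Algebra.TensorProduct.lift (Algebra.ofId K A) A₀.val hcomm
    have hμ : μ.toLinearMap = ((b₀.baseChange K).equiv b (Equiv.refl _)).toLinearMap := by
      refine (b₀.baseChange K).ext fun i => ?_
      rw [LinearEquiv.coe_coe, Basis.equiv_apply, Basis.baseChange_apply]
      exact (Algebra.TensorProduct.lift_tmul _ _ hcomm _ _).trans (by simp [hb₀])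
    exact ⟨AlgEquiv.ofBijective μ (by
      have := ((b₀.baseChange K).equiv b (Equiv.refl _)).bijective
      rw [← LinearEquiv.coe_coe, ← hμ] at this
      exact this)⟩

end Descent

/-! ### Matrix representations of an algebra -/

section Representation

variable {K : Type*} {Ω : Type*} [Field K] [Field Ω] [Algebra K Ω] {A : Type*} [Ring A]
  [Algebra K A] {X : Type*} [Fintype X] [DecidableEq X]

/-- An operator acting entrywise by scalars algebraic over `K` has a `K`-linear projection onto its
kernel. -/
theorem exists_projection [Algebra.IsAlgebraic K Ω] (ρ : A →ₐ[K] Matrix X X Ω) (T : A →ₗ[K] A)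
    (c : X → X → Ω) (hT : ∀ a x y, ρ (T a) x y = c x y * ρ a x y) :
    ∃ P : A →ₗ[K] A, ∀ a x y,
      (c x y = 0 → ρ (P a) x y = ρ a x y) ∧ (c x y ≠ 0 → ρ (P a) x y = 0) := by
  classical
  -- q vanishes at all nonzero scalars c x y but not at 0, so q(T)/q(0) acts as 1 where c is 0 and
  -- as 0 elsewhere.
  let q : Polynomial K :=
    ∏ z : X × X, if c z.1 z.2 = 0 then 1 else minpoly K (c z.1 z.2)
  have hq0 : q.eval 0 ≠ 0 := by
    rw [Polynomial.eval_prod]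
    refine Finset.prod_ne_zero_iff.2 fun z _ => ?_
    split_ifs with h
    · simp
    · rw [← Polynomial.coeff_zero_eq_eval_zero]
      exact minpoly.coeff_zero_ne_zero (Algebra.IsIntegral.isIntegral _) h
  have hq : ∀ x y, c x y ≠ 0 → Polynomial.aeval (c x y) q = 0 := by
    intro x y h
    rw [map_prod]
    refine Finset.prod_eq_zero (Finset.mem_univ (x, y)) ?_
    rw [if_neg h, minpoly.aeval]
  have hp : ∀ (p : Polynomial K) a x y,
      ρ (Polynomial.aeval T p a) x y = Polynomial.aeval (c x y) p * ρ a x y := by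
    intro p
    induction p using Polynomial.induction_on' with
    | add p q hp hq => intro a x y; simp [hp, hq, add_mul]
    | monomial n t =>
      have hpow : ∀ n a x y, ρ ((T ^ n) a) x y = c x y ^ n * ρ a x y := by
        intro n
        induction n with
        | zero => simp
        | succ n ih => intro a x y; rw [pow_succ, Module.End.mul_apply, ih, hT, pow_succ, mul_assoc]
      intro a x y
      rw [Polynomial.aeval_monomial, Polynomial.aeval_monomial, Module.End.mul_apply,
        Module.algebraMap_end_apply, map_smul, Matrix.smul_apply, hpow, Algebra.smul_def, mul_assoc]
  refine ⟨Polynomial.aeval T (Polynomial.C (q.eval 0)⁻¹ * q), fun a x y => ?_⟩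
  rw [hp]
  refine ⟨fun h => ?_, fun h => ?_⟩
  · rw [h, map_mul, Polynomial.aeval_C, ← map_zero (algebraMap K Ω),
      Polynomial.aeval_algebraMap_apply, ← map_mul, Polynomial.coe_aeval_eq_eval,
      inv_mul_cancel₀ hq0, map_one, one_mul]
  · rw [map_mul, hq x y h, mul_zero, zero_mul]

/-- A nonzero polynomial in the entries of a family of matrices does not vanish on all families
coming from `A`. -/
theorem exists_eval_entries_ne_zero [Infinite K] [FiniteDimensional K A]
    (ρ : A →ₐ[K] Matrix X X Ω) (hspan : Submodule.span Ω (Set.range ρ) = ⊤) {ι : Type*} [Finite ι]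
    (f : MvPolynomial (ι × X × X) Ω) (hf : f ≠ 0) :
    ∃ α : ι → A, MvPolynomial.eval (fun z => ρ (α z.1) z.2.1 z.2.2) f ≠ 0 := by
  classical
  have := Fintype.ofFinite ι
  have : Infinite Ω := Infinite.of_injective _ (algebraMap K Ω).injective
  let b := Module.finBasis K A
  let κ := Fin (finrank K A)
  -- Substitute the entries of generic combinations of a K-basis of A. The result is nonzero because
  -- the basis spans all matrices over Ω, and a nonzero polynomial has a nonzero value at some
  -- K-point since K is infinite.
  let φ : MvPolynomial (ι × X × X) Ω →ₐ[Ω] MvPolynomial (ι × κ) Ω :=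
    MvPolynomial.aeval fun z => ∑ s : κ, MvPolynomial.C (ρ (b s) z.2.1 z.2.2) *
      MvPolynomial.X (z.1, s)
  have hφ : ∀ (t : ι × κ → Ω), MvPolynomial.eval t (φ f) =
      MvPolynomial.eval (fun z => (∑ s, t (z.1, s) • ρ (b s)) z.2.1 z.2.2) f := by
    intro t
    have : (MvPolynomial.aeval t).comp φ =
        MvPolynomial.aeval (fun z => (∑ s, t (z.1, s) • ρ (b s)) z.2.1 z.2.2) := by
      ext z
      simp [φ, Matrix.sum_apply, mul_comm]
    exact DFunLike.congr_fun this f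
  have hφ0 : φ f ≠ 0 := by
    intro h0
    apply hf
    refine MvPolynomial.funext fun v => ?_
    rw [map_zero]
    have hv : ∀ i, ∃ t : κ → Ω, ∑ s, t s • ρ (b s) = Matrix.of fun x y => v (i, x, y) := by
      intro i
      rw [← Submodule.mem_span_range_iff_exists_fun]
      have : Submodule.span Ω (Set.range fun s => ρ (b s)) = ⊤ := by
        rw [eq_top_iff, ← hspan, Submodule.span_le]
        rintro _ ⟨a, rfl⟩
        rw [← b.sum_repr a, map_sum]
        refine Submodule.sum_mem _ fun s _ => ?_
        rw [map_smul, ← algebraMap_smul Ω]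
        exact Submodule.smul_mem _ _ (Submodule.subset_span ⟨s, rfl⟩)
      rw [this]; trivial
    choose t ht using hv
    have := hφ fun z => t z.1 z.2
    rw [h0, map_zero] at this
    rw [this]
    simp [ht]
  by_contra! hcon
  apply hφ0
  refine MvPolynomial.funext_set (fun _ => Set.range (algebraMap K Ω))
    (fun _ => Set.infinite_range_of_injective (algebraMap K Ω).injective) fun t ht => ?_
  choose t' ht' using fun z => ht z trivial
  rw [hφ, map_zero, ← hcon fun i => ∑ s, t' (i, s) • b s]
  congr 2
  ext z
  simp only [← ht', algebraMap_smul, map_sum, map_smul]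

/-- Conjugating a representation by an invertible matrix. -/
def conjRep (ρ : A →ₐ[K] Matrix X X Ω) (P : (Matrix X X Ω)ˣ) : A →ₐ[K] Matrix X X Ω :=
  AlgHom.ofLinearMap
    { toFun := fun a => (↑P⁻¹ : Matrix X X Ω) * ρ a * P
      map_add' := fun a b => by rw [map_add, mul_add, add_mul]
      map_smul' := fun c a => by simp }
    (by simp)
    (fun a b => by simp [mul_assoc])

theorem conjRep_apply (ρ : A →ₐ[K] Matrix X X Ω) (P : (Matrix X X Ω)ˣ) (a : A) :
    conjRep ρ P a = (↑P⁻¹ : Matrix X X Ω) * ρ a * P := rfl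

theorem span_image_conjRep (ρ : A →ₐ[K] Matrix X X Ω) (P : (Matrix X X Ω)ˣ) (S : Set A)
    (h : Submodule.span Ω (ρ '' S) = ⊤) : Submodule.span Ω (conjRep ρ P '' S) = ⊤ := by
  rw [eq_top_iff]
  intro M _
  have hM : (P : Matrix X X Ω) * M * (↑P⁻¹ : Matrix X X Ω) ∈ Submodule.span Ω (ρ '' S) :=
    h ▸ Submodule.mem_top
  let φ : Matrix X X Ω →ₗ[Ω] Matrix X X Ω :=
    LinearMap.mulRight Ω (P : Matrix X X Ω) ∘ₗ LinearMap.mulLeft Ω (↑P⁻¹ : Matrix X X Ω)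
  have hle : Submodule.span Ω (ρ '' S) ≤ (Submodule.span Ω (conjRep ρ P '' S)).comap φ :=
    Submodule.span_le.2 (by
      rintro _ ⟨a, ha, rfl⟩
      exact Submodule.subset_span ⟨a, ha, rfl⟩)
  have := hle hM
  simpa [φ, mul_assoc] using this

theorem span_range_conjRep (ρ : A →ₐ[K] Matrix X X Ω) (P : (Matrix X X Ω)ˣ)
    (h : Submodule.span Ω (Set.range ρ) = ⊤) :
    Submodule.span Ω (Set.range (conjRep ρ P)) = ⊤ := by
  rw [← Set.image_univ] at h ⊢
  exact span_image_conjRep ρ P _ h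

/-- A matrix annihilated by a separable polynomial is diagonalizable over an algebraically closed
field. -/
theorem exists_diagonal_conj [IsAlgClosed Ω] (M : Matrix X X Ω) (p : Polynomial Ω)
    (hp : p.Separable) (hM : Polynomial.aeval M p = 0) :
    ∃ (P : (Matrix X X Ω)ˣ) (d : X → Ω),
      (↑P⁻¹ : Matrix X X Ω) * M * P = Matrix.diagonal d := by
  classical
  let T : Module.End Ω (X → Ω) := Matrix.toLin' M
  have hT : Polynomial.aeval T p = 0 := by
    have := Polynomial.aeval_algHom_apply (Matrix.toLinAlgEquiv' (R := Ω) (n := X)) M p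
    rw [hM, map_zero] at this
    exact this
  have hss : T.IsSemisimple :=
    Module.End.isSemisimple_of_squarefree_aeval_eq_zero hp.squarefree hT
  have hint := DirectSum.isInternal_submodule_of_iSupIndep_of_iSup_eq_top
    T.eigenspaces_iSupIndep hss.iSup_eigenspace_eq_top
  let bs := hint.collectedBasis fun μ => Module.finBasis Ω (T.eigenspace μ)
  have hfin : Fintype (Σ μ, Fin (finrank Ω (T.eigenspace μ))) :=
    Module.Basis.fintypeIndexOfRankLtAleph0 bs (by simp)
  have hcard : Fintype.card (Σ μ, Fin (finrank Ω (T.eigenspace μ))) = Fintype.card X := by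
    rw [← Module.finrank_eq_card_basis bs, Module.finrank_fintype_fun_eq_card]
  let e := Fintype.equivOfCardEq hcard
  let b := bs.reindex e
  let d : X → Ω := fun x => (e.symm x).1
  have hb : ∀ x, T (b x) = d x • b x := by
    intro x
    have := hint.collectedBasis_mem (fun μ => Module.finBasis Ω (T.eigenspace μ)) (e.symm x)
    rw [Module.End.mem_eigenspace_iff] at this
    simpa only [b, d, bs, Basis.reindex_apply] using this
  let c := Pi.basisFun Ω X
  refine ⟨⟨c.toMatrix b, b.toMatrix c, c.toMatrix_mul_toMatrix_flip b,
    b.toMatrix_mul_toMatrix_flip c⟩, d, ?_⟩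
  change b.toMatrix c * M * c.toMatrix b = _
  have hMT : M = LinearMap.toMatrix c c T := by
    simp [T, c, LinearMap.toMatrix_eq_toMatrix']
  rw [hMT, basis_toMatrix_mul_linearMap_toMatrix_mul_basis_toMatrix]
  ext x y
  rw [LinearMap.toMatrix_apply, hb, map_smul, Basis.repr_self, Matrix.diagonal_apply]
  by_cases hxy : x = y
  · simp [hxy]
  · simp [hxy]

/-- If the matrix of the traces of the powers of `M` is nonsingular, the characteristic polynomial
of `M` is separable. -/
theorem separable_charpoly_of_det_trace_pow_ne_zero [IsAlgClosed Ω] (M : Matrix X X Ω)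
    {n : ℕ} (hn : Fintype.card X = n)
    (h : (Matrix.of fun i j : Fin n => (M ^ (i + j : ℕ)).trace).det ≠ 0) :
    M.charpoly.Separable := by
  classical
  -- p is the product over the distinct eigenvalues, so p(M) is nilpotent and p(M) M^j has trace 0
  -- for all j. If p had degree below n, its coefficients would be a nonzero vector in the left
  -- kernel of the trace matrix.
  let p : Polynomial Ω := ∏ r ∈ M.charpoly.roots.toFinset, (Polynomial.X - Polynomial.C r)
  have hsplit : M.charpoly = (M.charpoly.roots.map fun r => Polynomial.X - Polynomial.C r).prod :=
    (IsAlgClosed.splits M.charpoly).eq_prod_roots_of_monic M.charpoly_monic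
  have hnil : IsNilpotent (Polynomial.aeval M p) := by
    obtain ⟨N, hN⟩ := Multiset.le_smul_dedup M.charpoly.roots
    refine ⟨N, ?_⟩
    have hdvd : M.charpoly ∣ p ^ N := by
      have := Multiset.prod_dvd_prod_of_le
        (Multiset.map_le_map (f := fun r => Polynomial.X - Polynomial.C r) hN)
      rw [← hsplit, Multiset.map_nsmul, Multiset.prod_nsmul] at this
      exact this
    obtain ⟨q, hq⟩ := hdvd
    rw [← map_pow, hq, map_mul, Matrix.aeval_self_charpoly, zero_mul]
  have htr : ∀ j : ℕ, (Polynomial.aeval M p * M ^ j).trace = 0 := by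
    intro j
    have hc : Commute (Polynomial.aeval M p) (M ^ j) := by
      have := (Commute.all p (Polynomial.X ^ j)).map (Polynomial.aeval M)
      rwa [map_pow, Polynomial.aeval_X] at this
    exact (Matrix.isNilpotent_trace_of_isNilpotent (hc.isNilpotent_mul_right hnil)).eq_zero
  have hdeg : n ≤ p.natDegree := by
    by_contra! hlt
    let v : Fin n → Ω := fun i => p.coeff i
    have hv : Matrix.vecMul v (Matrix.of fun i j : Fin n => (M ^ (i + j : ℕ)).trace) = 0 := by
      ext j
      rw [Pi.zero_apply, ← htr j, Polynomial.aeval_eq_sum_range' hlt, Finset.sum_mul,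
        Matrix.trace_sum, Finset.sum_range]
      simp [Matrix.vecMul, dotProduct, v, pow_add]
    have hv0 := Matrix.eq_zero_of_vecMul_eq_zero h hv
    have := congrFun hv0 ⟨p.natDegree, hlt⟩
    have hmon : p.Monic := Polynomial.monic_prod_X_sub_C _ _
    simp [v, hmon] at this
  rw [Polynomial.natDegree_finsetProd_X_sub_C_eq_card, Multiset.card_toFinset] at hdeg
  have hroots : Multiset.card M.charpoly.roots = n := by
    rw [← (IsAlgClosed.splits M.charpoly).natDegree_eq_card_roots, M.charpoly_natDegree_eq_dim, hn]
  rw [← Polynomial.nodup_roots_iff_of_splits M.charpoly_monic.ne_zero (IsAlgClosed.splits _),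
    ← Multiset.dedup_eq_self]
  exact Multiset.eq_of_le_of_card_le (Multiset.dedup_le _) (by rw [hroots]; exact hdeg)

end Representation

/-! ### Splittings adapted to a Galois subfield -/

section Adapted

variable {K : Type*} {Ω : Type*} [Field K] [Field Ω] [Algebra K Ω] {A : Type*} [Ring A]
  [Algebra K A] {F : Type*} [Field F] [Algebra K F]

theorem exists_conjRep_diagonal [IsAlgClosed Ω] [Algebra.IsSeparable K F] {X : Type*} [Fintype X]
    [DecidableEq X] (ρ : A →ₐ[K] Matrix X X Ω) (j : F →ₐ[K] A) (φ : F) :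
    ∃ (P : (Matrix X X Ω)ˣ) (d : X → Ω), conjRep ρ P (j φ) = Matrix.diagonal d :=
  exists_diagonal_conj (ρ (j φ)) ((minpoly K φ).map (algebraMap K Ω))
    (Polynomial.Separable.map (Algebra.IsSeparable.isSeparable K φ)) (by
      rw [Polynomial.aeval_map_algebraMap, Polynomial.aeval_algHom_apply,
        Polynomial.aeval_algHom_apply, minpoly.aeval, map_zero, map_zero])

/-- If a primitive element of `F` is represented by a diagonal matrix, then all of `F` is, and the
diagonal entries are conjugates. -/
theorem exists_characters [IsAlgClosed Ω] [FiniteDimensional K F] [IsGalois K F] {X : Type*}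
    [Fintype X] [DecidableEq X] (ρ : A →ₐ[K] Matrix X X Ω) (j : F →ₐ[K] A) {φ : F}
    (hφ : IntermediateField.adjoin K {φ} = ⊤) (d : X → Ω) (hd : ρ (j φ) = Matrix.diagonal d) :
    ∃ (ι : F →ₐ[K] Ω) (π : X → (F ≃ₐ[K] F)),
      ∀ f, ρ (j f) = Matrix.diagonal fun x => ι (π x f) := by
  have hφint : IsIntegral K φ := Algebra.IsIntegral.isIntegral φ
  have hoff : ∀ f x y, x ≠ y → ρ (j f) x y = 0 := by
    have hφS : φ ∈ (Matrix.diagonalAlgHom K (α := Ω) (n := X)).range.comap (ρ.comp j) :=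
      ⟨d, hd.symm⟩
    have htop : Algebra.adjoin K {φ} = ⊤ := by
      rw [← IntermediateField.adjoin_simple_toSubalgebra_of_isAlgebraic hφint.isAlgebraic, hφ,
        IntermediateField.top_toSubalgebra]
    intro f x y hxy
    obtain ⟨e, he⟩ :=
      (Algebra.adjoin_le (Set.singleton_subset_iff.2 hφS)) (htop ▸ Algebra.mem_top (x := f))
    replace he : Matrix.diagonal e = ρ (j f) := he
    rw [← he, Matrix.diagonal_apply_ne _ hxy]
  let χ : X → F →ₐ[K] Ω := fun x =>
    { toFun := fun f => ρ (j f) x x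
      map_one' := by simp
      map_mul' := fun f g => by
        rw [map_mul, map_mul, Matrix.mul_apply, Finset.sum_eq_single x]
        · intro y _ hy
          rw [hoff f x y hy.symm, zero_mul]
        · simp
      map_zero' := by simp
      map_add' := by simp
      commutes' := fun c => by
        rw [AlgHom.commutes, AlgHom.commutes, Matrix.algebraMap_matrix_apply, if_pos rfl] }
  -- Since F is normal, every embedding of F in Ω is this fixed one preceded by an automorphism of
  -- F.
  let ι : F →ₐ[K] Ω := IsAlgClosed.lift
  let _ : Algebra F Ω := ι.toRingHom.toAlgebra
  have : IsScalarTower K F Ω := IsScalarTower.of_algebraMap_eq fun c => (ι.commutes c).symm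
  refine ⟨ι, fun x => Normal.algHomEquivAut K Ω F (χ x), fun f => ?_⟩
  ext x y
  by_cases hxy : x = y
  · subst hxy
    rw [Matrix.diagonal_apply_eq]
    have := DFunLike.congr_fun ((Normal.algHomEquivAut K Ω F).symm_apply_apply (χ x)) f
    exact this.symm
  · rw [hoff f x y hxy, Matrix.diagonal_apply_ne _ hxy]

/-- A generic θ in the centralizer of F has separable characteristic polynomial. Diagonalizing θ
with distinct eigenvalues makes everything commuting with it diagonal, in particular F. -/
theorem exists_adapted_splitting [IsAlgClosed Ω] [Algebra.IsAlgebraic K Ω] [Infinite K]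
    [IsSimpleRing A] [Algebra.IsCentral K A] [FiniteDimensional K A] [FiniteDimensional K F]
    [IsGalois K F] (j : F →ₐ[K] A) :
    ∃ (n : ℕ) (_ : NeZero n) (ρ : A →ₐ[K] Matrix (Fin n) (Fin n) Ω) (ι : F →ₐ[K] Ω)
      (π : Fin n → (F ≃ₐ[K] F)) (θ : A) (d : Fin n → Ω),
      finrank K A = n ^ 2 ∧ Submodule.span Ω (Set.range ρ) = ⊤ ∧ Function.Injective d ∧
      ρ θ = Matrix.diagonal d ∧ ∀ f, ρ (j f) = Matrix.diagonal fun x => ι (π x f) := by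
  classical
  obtain ⟨n, hn, ρ₀, hcard, hspan₀⟩ := exists_splitting K Ω A
  obtain ⟨φ, hφ⟩ := Field.exists_primitive_element K F
  obtain ⟨P₁, d₁, hd₁⟩ := exists_conjRep_diagonal ρ₀ j φ
  set ρ₁ := conjRep ρ₀ P₁ with hρ₁
  have hspan₁ := span_range_conjRep ρ₀ P₁ hspan₀
  -- P projects A onto the centralizer of j φ, the block diagonal elements for the eigenvalues d₁.
  obtain ⟨P, hP⟩ := exists_projection ρ₁
    (LinearMap.mulLeft K (j φ) - LinearMap.mulRight K (j φ)) (fun x y => d₁ x - d₁ y) (by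
      intro a x y
      simp [hd₁, Matrix.diagonal_mul, Matrix.mul_diagonal]
      ring)
  let G : Matrix (Fin n) (Fin n) (MvPolynomial (Unit × Fin n × Fin n) Ω) :=
    Matrix.of fun x y => if d₁ x = d₁ y then MvPolynomial.X ((), x, y) else 0
  -- The discriminant of a generic block diagonal matrix. It is nonzero, being a squared Vandermonde
  -- determinant at a diagonal matrix with distinct entries.
  let f : MvPolynomial (Unit × Fin n × Fin n) Ω :=
    (Matrix.of fun i j : Fin n => (G ^ (i + j : ℕ)).trace).det
  have hf : ∀ v, MvPolynomial.eval v f = (Matrix.of fun i j : Fin n =>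
      ((G.map (MvPolynomial.eval v)) ^ (i + j : ℕ)).trace).det := by
    intro v
    rw [RingHom.map_det]
    congr 1
    ext i j
    simp only [RingHom.mapMatrix_apply, Matrix.map_apply, Matrix.of_apply]
    rw [← RingHom.mapMatrix_apply, ← map_pow (RingHom.mapMatrix (MvPolynomial.eval v))]
    simp [Matrix.trace]
  have hf0 : f ≠ 0 := by
    intro h0
    have : Infinite Ω := Infinite.of_injective _ (algebraMap K Ω).injective
    let e : Fin n ↪ Ω := Fin.valEmbedding.trans (Infinite.natEmbedding Ω)
    have h1 := hf fun z => if z.2.1 = z.2.2 then e z.2.1 else 0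
    have h2 : G.map (MvPolynomial.eval fun z => if z.2.1 = z.2.2 then e z.2.1 else 0)
        = Matrix.diagonal e := by
      ext x y
      by_cases hxy : x = y
      · simp [G, hxy]
      · by_cases hd : d₁ x = d₁ y <;> simp [G, hxy, hd]
    have h3 : (Matrix.of fun i j : Fin n => ((Matrix.diagonal e) ^ (i + j : ℕ)).trace)
        = (Matrix.vandermonde e).transpose * Matrix.vandermonde e := by
      ext i j
      simp [Matrix.diagonal_pow, Matrix.mul_apply, pow_add, Matrix.vandermonde_apply]
    rw [h0, map_zero, h2, h3, Matrix.det_mul, Matrix.det_transpose] at h1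
    exact mul_self_ne_zero.2 (Matrix.det_vandermonde_ne_zero_iff.2 e.injective) h1.symm
  obtain ⟨α, hα⟩ := exists_eval_entries_ne_zero ρ₁ hspan₁ f hf0
  set θ := P (α ()) with hθ
  have hGθ : G.map (MvPolynomial.eval fun z => ρ₁ (α z.1) z.2.1 z.2.2) = ρ₁ θ := by
    ext x y
    by_cases hd : d₁ x = d₁ y
    · simp [G, hd, (hP (α ()) x y).1 (sub_eq_zero.2 hd), hθ]
    · simp [G, hd, (hP (α ()) x y).2 (sub_ne_zero.2 hd), hθ]
  rw [hf, hGθ] at hα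
  have hsep := separable_charpoly_of_det_trace_pow_ne_zero (ρ₁ θ) (Fintype.card_fin n) hα
  obtain ⟨P₂, d, hd⟩ := exists_diagonal_conj (ρ₁ θ) _ hsep (Matrix.aeval_self_charpoly _)
  have hdinj : Function.Injective d := by
    have hch := Matrix.charpoly_units_conj' P₂ (ρ₁ θ)
    rw [← Matrix.coe_units_inv, hd] at hch
    rw [← hch, Matrix.charpoly_diagonal,
      Polynomial.separable_prod_X_sub_C_iff] at hsep
    exact hsep
  set ρ := conjRep ρ₁ P₂ with hρ
  replace hd : ρ θ = Matrix.diagonal d := hd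
  have hcomm₁ : ρ₁ (j φ * θ) = ρ₁ (θ * j φ) := by
    rw [map_mul, map_mul, hd₁]
    ext x y
    rw [Matrix.diagonal_mul, Matrix.mul_diagonal]
    by_cases hd : d₁ x = d₁ y
    · rw [hd, mul_comm]
    · rw [(hP (α ()) x y).2 (sub_ne_zero.2 hd), mul_zero, zero_mul]
  have hφdiag : ρ (j φ) = Matrix.diagonal fun x => ρ (j φ) x x := by
    have hcomm : ρ (j φ) * ρ θ = ρ θ * ρ (j φ) := by
      rw [← map_mul, ← map_mul, hρ, conjRep_apply ρ₁, conjRep_apply ρ₁, hcomm₁]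
    ext x y
    by_cases hxy : x = y
    · rw [hxy, Matrix.diagonal_apply_eq]
    · have := congrFun (congrFun hcomm x) y
      rw [hd, Matrix.diagonal_mul, Matrix.mul_diagonal, mul_comm, ← sub_eq_zero, ← sub_mul] at this
      rw [Matrix.diagonal_apply_ne _ hxy]
      exact (mul_eq_zero.1 this).resolve_left (sub_ne_zero.2 (hdinj.ne (Ne.symm hxy)))
  obtain ⟨ι, π, hπ⟩ := exists_characters ρ j hφ _ hφdiag
  exact ⟨n, hn, ρ, ι, π, θ, d, hcard, span_range_conjRep ρ₁ P₂ hspan₁, hdinj, hd, hπ⟩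

/-- All characters of `F` occur equally often in an adapted splitting. -/
theorem card_fiber_mul_finrank [FiniteDimensional K A] [FiniteDimensional K F] [IsGalois K F]
    {X : Type*} [Fintype X] [DecidableEq X] [Nonempty X] (ρ : A →ₐ[K] Matrix X X Ω)
    (hcard : finrank K A = Fintype.card X ^ 2) (hspan : Submodule.span Ω (Set.range ρ) = ⊤)
    (j : F →ₐ[K] A) (ι : F →ₐ[K] Ω) (π : X → (F ≃ₐ[K] F))
    (hj : ∀ f, ρ (j f) = Matrix.diagonal fun x => ι (π x f)) (q : F ≃ₐ[K] F) :
    Nat.card {x // π x = q} * finrank K F = Fintype.card X := by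
  classical
  let _ : Module F A := Module.compHom A j.toRingHom
  have hsmul : ∀ (f : F) (a : A), f • a = j f * a := fun _ _ => rfl
  have : IsScalarTower K F A := ⟨fun c f a => by
    rw [hsmul, hsmul, map_smul, smul_mul_assoc]⟩
  have : Module.Finite F A := Module.Finite.of_restrictScalars_finite K F A
  have hmul : finrank K F * finrank F A = Fintype.card X ^ 2 := by
    rw [finrank_mul_finrank, hcard]
  have hXpos : 0 < Fintype.card X := Fintype.card_pos
  have hle : ∀ q : F ≃ₐ[K] F, Nat.card {x // π x = q} * finrank K F ≤ Fintype.card X := by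
    intro q
    -- On the rows in the fibre of q, F acts through the single character ι ∘ q. These rows are
    -- therefore spanned over Ω by the images of an F-basis of A, which bounds the size of the
    -- fibre.
    let E : Matrix X X Ω →ₗ[Ω] ({x // π x = q} × X → Ω) :=
      { toFun := fun M z => M z.1 z.2
        map_add' := fun _ _ => rfl
        map_smul' := fun _ _ => rfl }
    have hEapp : ∀ M z, E M z = M z.1 z.2 := fun _ _ => rfl
    have hE : Function.Surjective E := by
      intro v
      refine ⟨Matrix.of fun x y => if h : π x = q then v (⟨x, h⟩, y) else 0, ?_⟩
      ext ⟨⟨x, hx⟩, y⟩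
      simp [hEapp, hx]
    let b := Module.finBasis F A
    have hE' : Submodule.span Ω (Set.range fun s => E (ρ (b s))) = ⊤ := by
      rw [eq_top_iff, ← LinearMap.range_eq_top.2 hE, LinearMap.range_eq_map, ← hspan,
        Submodule.map_span, Submodule.span_le]
      rintro _ ⟨_, ⟨a, rfl⟩, rfl⟩
      have : E (ρ a) = ∑ s, ι (q (b.repr a s)) • E (ρ (b s)) := by
        conv_lhs => rw [← b.sum_repr a]
        rw [map_sum, map_sum]
        refine Finset.sum_congr rfl fun s _ => ?_
        ext ⟨⟨x, hx⟩, y⟩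
        simp [hEapp, hsmul, hj, Matrix.diagonal_mul, hx]
      rw [this]
      exact Submodule.sum_mem _ fun s _ =>
        Submodule.smul_mem _ _ (Submodule.subset_span ⟨s, rfl⟩)
    have h1 := finrank_range_le_card (R := Ω) (fun s => E (ρ (b s)))
    rw [Set.finrank, hE', finrank_top, Module.finrank_fintype_fun_eq_card, Fintype.card_prod,
      Fintype.card_fin] at h1
    rw [Nat.card_eq_fintype_card]
    refine Nat.le_of_mul_le_mul_right (c := Fintype.card X) ?_ hXpos
    calc _ = finrank K F * (Fintype.card {x // π x = q} * Fintype.card X) := by ring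
      _ ≤ finrank K F * finrank F A := Nat.mul_le_mul_left _ h1
      _ = _ := by rw [hmul, sq]
  -- The fibres partition X, so the upper bounds add up to an equality and each of them is attained.
  have hsum : ∑ q : F ≃ₐ[K] F, Nat.card {x // π x = q} * finrank K F
      = ∑ _q : F ≃ₐ[K] F, Fintype.card X := by
    rw [← Finset.sum_mul, Finset.sum_const, Finset.card_univ,
      ← Nat.card_eq_fintype_card (α := F ≃ₐ[K] F), IsGalois.card_aut_eq_finrank, smul_eq_mul, mul_comm]
    congr 1
    simp only [Nat.card_eq_fintype_card]
    rw [← Fintype.card_sigma]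
    exact Fintype.card_congr (Equiv.sigmaFiberEquiv π)
  exact (Finset.sum_eq_sum_iff_of_le fun q _ => hle q).1 hsum q (Finset.mem_univ q)

/-- The degree of a Galois subfield divides the degree of the algebra. -/
theorem finrank_dvd_of_algHom [IsSimpleRing A] [Algebra.IsCentral K A] [FiniteDimensional K A]
    [FiniteDimensional K F] [IsGalois K F] (j : F →ₐ[K] A) {n : ℕ} (hn : finrank K A = n ^ 2) :
    finrank K F ∣ n := by
  obtain ⟨n', _, ρ, hcard, hspan⟩ := exists_splitting K (AlgebraicClosure K) A
  obtain rfl : n' = n := Nat.pow_left_injective (n := 2) (by norm_num) (hcard.symm.trans hn)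
  obtain ⟨φ, hφ⟩ := Field.exists_primitive_element K F
  obtain ⟨P, d, hd⟩ := exists_conjRep_diagonal ρ j φ
  obtain ⟨ι, π, hπ⟩ := exists_characters _ j hφ d hd
  have := card_fiber_mul_finrank (conjRep ρ P) (by rw [hcard, Fintype.card_fin])
    (span_range_conjRep ρ P hspan) j ι π hπ 1
  rw [Fintype.card_fin] at this
  exact Dvd.intro_left _ this

end Adapted

/-! ### Combinatorics of the support digraph -/

section Digraph

/-- The parent of x is the next vertex on a shortest path to x₀. The root is its own parent, so one
number N of iterations serves all x. -/
theorem exists_parent {X : Type*} [Finite X] (R : X → X → Prop) (x₀ : X)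
    (h : ∀ x, Relation.ReflTransGen R x x₀) :
    ∃ (p : X → X) (N : ℕ), (∀ x, x ≠ x₀ → R x (p x)) ∧ ∀ x, p^[N] x = x₀ := by
  classical
  have := Fintype.ofFinite X
  let D : ℕ → X → Prop := fun n => Nat.rec (fun x => x = x₀) (fun _ D x => ∃ y, R x y ∧ D y) n
  have hD0 : ∀ x, D 0 x ↔ x = x₀ := fun x => Iff.rfl
  have hDs : ∀ n x, D (n + 1) x ↔ ∃ y, R x y ∧ D n y := fun n x => Iff.rfl
  have hD : ∀ x, ∃ n, D n x := fun x => by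
    induction h x using Relation.ReflTransGen.head_induction_on with
    | refl => exact ⟨0, rfl⟩
    | head hxy _ ih =>
      obtain ⟨n, hn⟩ := ih
      exact ⟨n + 1, _, hxy, hn⟩
  let ht : X → ℕ := fun x => sInf {n | D n x}
  have hstep : ∀ x, ∃ y, (x = x₀ → y = x₀) ∧ (x ≠ x₀ → R x y ∧ ht y < ht x) := by
    intro x
    by_cases hx : x = x₀
    · exact ⟨x₀, fun _ => rfl, fun h => absurd hx h⟩
    have hspec : D (ht x) x := Nat.sInf_mem (hD x)
    rcases hn : ht x with _ | n
    · rw [hn] at hspec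
      exact absurd hspec hx
    · rw [hn] at hspec
      obtain ⟨y, hxy, hy⟩ := hspec
      exact ⟨y, fun h => absurd h hx, fun _ => ⟨hxy, Nat.lt_succ_of_le (Nat.sInf_le hy)⟩⟩
  choose p hp₀ hp using hstep
  have hfix : ∀ n, p^[n] x₀ = x₀ := fun n => Function.iterate_fixed (hp₀ x₀ rfl) n
  have hreach : ∀ n x, ht x ≤ n → p^[n] x = x₀ := by
    intro n
    induction n with
    | zero =>
      intro x hx
      have hspec : D (ht x) x := Nat.sInf_mem (hD x)
      rw [Nat.le_zero.1 hx] at hspec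
      exact hspec
    | succ n ih =>
      intro x hx
      by_cases hx₀ : x = x₀
      · rw [hx₀]; exact hfix _
      · rw [Function.iterate_succ_apply]
        exact ih _ (by have := (hp x hx₀).2; omega)
  exact ⟨p, Finset.univ.sup ht, fun x hx => (hp x hx).1,
    fun x => hreach _ x (Finset.le_sup (Finset.mem_univ x))⟩

/-- Potentials along a rooted tree. -/
theorem exists_potential {X Ω : Type*} [Field Ω] (x₀ : X) (p : X → X) (N : ℕ)
    (hN : ∀ x, p^[N] x = x₀) (c : X → Ω) (hc : ∀ x, x ≠ x₀ → c x ≠ 0) :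
    ∃ t : X → Ω, (∀ x, t x ≠ 0) ∧ ∀ x, x ≠ x₀ → t x = c x * t (p x) := by
  classical
  -- The potential of x is the product of the weights on its path to the root; weight 1 at the root
  -- absorbs the surplus iterations.
  let c' : X → Ω := fun x => if x = x₀ then 1 else c x
  have hc' : ∀ x, c' x ≠ 0 := fun x => by
    by_cases hx : x = x₀
    · simp [c', hx]
    · simp [c', hx, hc x hx]
  refine ⟨fun x => ∏ i ∈ Finset.range N, c' (p^[i] x),
    fun x => Finset.prod_ne_zero_iff.2 fun i _ => hc' _, fun x hx => ?_⟩
  have h1 := Finset.prod_range_succ (fun i => c' (p^[i] x)) N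
  rw [Finset.prod_range_succ', hN x, show c' x₀ = 1 from if_pos rfl, mul_one] at h1
  simp only [Function.iterate_succ_apply, Function.iterate_zero, id] at h1
  change ∏ i ∈ Finset.range N, c' (p^[i] x) = c x * ∏ i ∈ Finset.range N, c' (p^[i] (p x))
  rw [← h1, mul_comm, show c' x = c x from if_neg hx]

/-- In a finite group, products of generators without inverses suffice, and surjectivity of π
supplies the intermediate vertices. The identity is a positive power of a generator, so two points
of one fibre are also joined by a nonempty path. -/
theorem transGen_of_closure_eq_top {X Q ι : Type*} [Group Q] [Finite Q] [Nonempty ι] (π : X → Q)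
    (hπ : Function.Surjective π) (g : ι → Q) (hg : Subgroup.closure (Set.range g) = ⊤) (x y : X) :
    Relation.TransGen (fun x y => ∃ i, π y = π x * g i) x y := by
  let T : Subsemigroup Q :=
    { carrier := {h | ∀ x y, π y = π x * h →
        Relation.TransGen (fun x y => ∃ i, π y = π x * g i) x y}
      mul_mem' := fun {h h'} H H' x y hxy => by
        obtain ⟨z, hz⟩ := hπ (π x * h)
        exact (H x z hz).trans (H' z y (by rw [hxy, hz, mul_assoc])) }
  have hgT : ∀ i, g i ∈ T := fun i x y hxy => Relation.TransGen.single ⟨i, hxy⟩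
  have hpow : ∀ h ∈ T, ∀ n : ℕ, h ^ (n + 1) ∈ T := by
    intro h hh n
    induction n with
    | zero => simpa using hh
    | succ n ih => rw [pow_succ]; exact T.mul_mem ih hh
  have h1 : ∀ h ∈ T, (1 : Q) ∈ T := fun h hh => by
    have := hpow h hh (orderOf h - 1)
    rwa [Nat.sub_add_cancel (orderOf_pos h), pow_orderOf_eq_one] at this
  have hall : ∀ h : Q, h ∈ T := by
    intro h
    have hh : h ∈ Submonoid.closure (Set.range g) := by
      have : h ∈ (Subgroup.closure (Set.range g)).toSubmonoid := by rw [hg]; trivial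
      rwa [Subgroup.closure_toSubmonoid_of_finite] at this
    induction hh using Submonoid.closure_induction with
    | mem _ hx => obtain ⟨i, rfl⟩ := hx; exact hgT i
    | one => exact h1 _ (hgT (Classical.arbitrary ι))
    | mul _ _ _ _ hx hy => exact T.mul_mem hx hy
  exact hall ((π x)⁻¹ * π y) x y (by simp)

/-- The matrix whose row `x` has the single entry `c x` in column `σ x`. -/
def weightedMap {X Ω : Type*} [DecidableEq X] [Zero Ω] (c : X → Ω) (σ : X → X) : Matrix X X Ω :=
  Matrix.of fun x y => if σ x = y then c x else 0

theorem weightedMap_pow_mul {X Ω : Type*} [DecidableEq X] [Fintype X] [Field Ω] (c : X → Ω)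
    (σ : X → X) (B : Matrix X X Ω) (p : ℕ) (x y : X) :
    (weightedMap c σ ^ p * B) x y = (∏ i ∈ Finset.range p, c (σ^[i] x)) * B (σ^[p] x) y := by
  induction p generalizing x with
  | zero => simp
  | succ p ih =>
    have h1 : ∀ B : Matrix X X Ω, (weightedMap c σ * B) x y = c x * B (σ x) y := fun B => by
      simp [weightedMap, Matrix.mul_apply]
    rw [pow_succ', mul_assoc, h1, ih, Finset.prod_range_succ', Function.iterate_succ_apply]
    simp only [Function.iterate_succ_apply, Function.iterate_zero, id]
    ring

theorem weightedMap_pow {X Ω : Type*} [DecidableEq X] [Fintype X] [Field Ω] (c : X → Ω)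
    (σ : X → X) (p : ℕ) (x y : X) :
    (weightedMap c σ ^ p) x y
      = (∏ i ∈ Finset.range p, c (σ^[i] x)) * if σ^[p] x = y then 1 else 0 := by
  have := weightedMap_pow_mul c σ 1 p x y
  rwa [mul_one, Matrix.one_apply] at this

/-- The exponent is p + 1 because the zeroth iterate is x itself, which need not lie on the section
s. -/
theorem iterate_section {X Q : Type*} [Group Q] {π : X → Q} {s : Q → X} (hs : ∀ q, π (s q) = q)
    (g : Q) (p : ℕ) (x : X) : (fun z => s (π z * g))^[p + 1] x = s (π x * g ^ (p + 1)) := by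
  induction p with
  | zero => simp
  | succ p ih => rw [Function.iterate_succ_apply', ih, hs, mul_assoc, ← pow_succ]

/-- Over a set with large fibres, a power of a matrix supported on the digraph of `g` can have
distinct diagonal entries at two given places. -/
theorem exists_separating_power {X Q Ω : Type*} [DecidableEq X] [Fintype X] [Group Q] [Finite Q]
    [Field Ω] (π : X → Q) (g : Q) (hfib : ∀ q x, ∃ y, π y = q ∧ y ≠ x) {x y : X} (hxy : x ≠ y) :
    ∃ (a : Matrix X X Ω) (p : ℕ), (∀ x y, π y ≠ π x * g → a x y = 0) ∧
      (a ^ p) x x ≠ (a ^ p) y y := by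
  classical
  choose s₀ hs₀ hs₀' using fun q => hfib q y
  -- A section of π through x that avoids y. Following g along it for `orderOf g` steps returns x to
  -- x but moves y.
  let s : Q → X := fun q => if q = π x then x else s₀ q
  have hs : ∀ q, π (s q) = q := fun q => by
    by_cases hq : q = π x
    · simp [s, hq]
    · simp [s, hq, hs₀]
  have hsx : s (π x) = x := by simp [s]
  have hsy : s (π y) ≠ y := by
    by_cases hq : π y = π x
    · simpa [s, hq] using hxy
    · simpa [s, hq] using hs₀' (π y)
  refine ⟨weightedMap 1 fun z => s (π z * g), orderOf g, fun x y hne => ?_, ?_⟩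
  · rw [weightedMap, Matrix.of_apply, if_neg]
    rintro rfl
    exact hne (hs _)
  · have hit : ∀ z, (fun z => s (π z * g))^[orderOf g] z = s (π z) := fun z => by
      have := iterate_section hs g (orderOf g - 1) z
      rwa [Nat.sub_add_cancel (orderOf_pos g), pow_orderOf_eq_one, mul_one] at this
    rw [weightedMap_pow, weightedMap_pow, hit, hit, if_pos hsx, if_neg hsy]
    simp

/-- If `π` is bijective, a word in two matrices supported on the digraphs of `g i` and `g i'` can
have distinct diagonal entries at two given places. -/
theorem exists_separating_word {X Q Ω ι : Type*} [DecidableEq X] [Fintype X] [Group Q] [Finite Q]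
    [Field Ω] [DecidableEq ι] (π : X → Q) (hπ : Function.Bijective π) (g : ι → Q)
    {i₁ i₂ : ι} (hi : i₁ ≠ i₂) {x y : X} (hxy : x ≠ y) :
    ∃ (a : ι → Matrix X X Ω) (i i' : ι) (p p' : ℕ),
      (∀ i x y, π y ≠ π x * g i → a i x y = 0) ∧
      (a i ^ p * a i' ^ p') x x ≠ (a i ^ p * a i' ^ p') y y := by
  classical
  obtain ⟨s, hsl, hs⟩ := Function.bijective_iff_has_inverse.1 hπ
  let σ : ι → X → X := fun i z => s (π z * g i)
  have hσ : ∀ i p z, (σ i)^[p] z = s (π z * g i ^ p) := by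
    intro i p z
    rcases p with _ | p
    · simp [hsl z]
    · exact iterate_section hs (g i) p z
  -- Weight 0 at y kills every walk that starts there with a weighted step. A closed walk at x
  -- survives if it does not meet y before its last weighted step.
  let c : X → Ω := fun z => if z = y then 0 else 1
  let a : ι → ι → Matrix X X Ω := fun j i => weightedMap (if i = j then c else 1) (σ i)
  have hsupp : ∀ j i x y, π y ≠ π x * g i → a j i x y = 0 := by
    intro j i x y hne
    simp only [a, weightedMap, Matrix.of_apply]
    rw [if_neg]
    rintro rfl
    exact hne (hs _)
  have key : ∀ (j i' : ι) (p p' : ℕ), i' ≠ j ∨ p' = 0 → 0 < p → g j ^ p * g i' ^ p' = 1 →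
      (∀ q < p, π x * g j ^ q ≠ π y) →
      (a j j ^ p * a j i' ^ p') x x ≠ (a j j ^ p * a j i' ^ p') y y := by
    intro j i' p p' hi' hp hone hne
    have hajj : a j j = weightedMap c (σ j) := by simp [a]
    have haji' : a j i' ^ p' = weightedMap 1 (σ i') ^ p' := by
      rcases hi' with hi' | hi'
      · simp [a, hi']
      · simp [hi']
    have h1 : (a j j ^ p * a j i' ^ p') x x = 1 := by
      rw [hajj, haji', weightedMap_pow_mul, weightedMap_pow, if_pos, Finset.prod_eq_one]
      · simp
      · intro q hq
        simp only [c, hσ]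
        rw [if_neg]
        intro h
        apply hne q (Finset.mem_range.1 hq)
        rw [← h, hs]
      · rw [hσ, hσ, hs, mul_assoc, hone, mul_one, hsl]
    have h2 : (a j j ^ p * a j i' ^ p') y y = 0 := by
      rw [hajj, haji', weightedMap_pow_mul, Finset.prod_eq_zero (Finset.mem_range.2 hp), zero_mul]
      simp [c]
    rw [h1, h2]
    exact one_ne_zero
  have hπxy : π x ≠ π y := hπ.1.ne hxy
  -- If the cycle of some g j through x misses y, go once around it. Otherwise go from x to y along
  -- g i₁, where only the departure points are weighted, and return along g i₂, which is unweighted.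
  by_cases hz : ∃ j, (π x)⁻¹ * π y ∉ Subgroup.zpowers (g j)
  · obtain ⟨j, hj⟩ := hz
    refine ⟨a j, j, j, orderOf (g j), 0, hsupp j, key j j _ 0 (Or.inr rfl) (orderOf_pos _)
      (by simp [pow_orderOf_eq_one]) fun q _ h => hj ?_⟩
    rw [← h, inv_mul_cancel_left]
    exact Subgroup.npow_mem_zpowers _ _
  · push Not at hz
    obtain ⟨e, he, hge⟩ : ∃ e < orderOf (g i₁), g i₁ ^ e = (π x)⁻¹ * π y := by
      have := mem_zpowers_iff_mem_range_orderOf.1 (hz i₁)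
      simpa using this
    obtain ⟨t, -, ht⟩ : ∃ t < orderOf (g i₂), g i₂ ^ t = ((π x)⁻¹ * π y)⁻¹ := by
      have := mem_zpowers_iff_mem_range_orderOf.1 (Subgroup.inv_mem _ (hz i₂))
      simpa using this
    have hxe : π x * g i₁ ^ e = π y := by rw [hge, mul_inv_cancel_left]
    refine ⟨a i₁, i₁, i₂, e, t, hsupp i₁, key i₁ i₂ e t (Or.inl hi.symm) ?_ ?_ ?_⟩
    · rcases Nat.eq_zero_or_pos e with rfl | h
      · exact absurd (by simpa using hxe) hπxy
      · exact h
    · rw [hge, ht, mul_inv_cancel]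
    · intro q hq h
      rw [← hxe] at h
      exact hq.ne (pow_injOn_Iio_orderOf (Set.mem_Iio.2 (hq.trans he)) (Set.mem_Iio.2 he)
        (mul_left_cancel h))

/-- A subalgebra of a matrix algebra whose diagonal elements separate indices and whose support
digraph is strongly connected is everything. -/
theorem subalgebra_eq_top_of_separates {X Ω : Type*} [DecidableEq X] [Fintype X] [Field Ω]
    (S : Subalgebra Ω (Matrix X X Ω))
    (hsep : ∀ x y, x ≠ y → ∃ d : X → Ω, Matrix.diagonal d ∈ S ∧ d x ≠ d y)
    (hconn : ∀ x y, Relation.TransGen (fun x y => ∃ M ∈ S, M x y ≠ 0) x y) : S = ⊤ := by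
  classical
  let S' : Subalgebra Ω (X → Ω) := S.comap (Matrix.diagonalAlgHom Ω)
  have hS' : ∀ d, d ∈ S' ↔ Matrix.diagonal d ∈ S := fun d => Iff.rfl
  choose! d hd hdne using hsep
  have hidem : ∀ x, Matrix.single x x (1 : Ω) ∈ S := by
    intro x
    -- Lagrange interpolation: each factor is 1 at x and 0 at y.
    let e : X → Ω := ∏ y ∈ Finset.univ.erase x,
      ((d x y x - d x y y)⁻¹ • (d x y - algebraMap Ω (X → Ω) (d x y y)))
    have he : e ∈ S' := Subalgebra.prod_mem _ fun y hy =>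
      Subalgebra.smul_mem _ (Subalgebra.sub_mem _
        ((hS' _).2 (hd x y (Finset.ne_of_mem_erase hy).symm)) (Subalgebra.algebraMap_mem _ _)) _
    have heq : e = Pi.single x 1 := by
      ext z
      by_cases hz : z = x
      · subst hz
        simp only [e, Finset.prod_apply, Pi.single_eq_same]
        refine Finset.prod_eq_one fun y hy => ?_
        have := hdne z y (Finset.ne_of_mem_erase hy).symm
        simp [inv_mul_cancel₀ (sub_ne_zero.2 this)]
      · rw [Pi.single_eq_of_ne hz]
        simp only [e, Finset.prod_apply]
        exact Finset.prod_eq_zero (Finset.mem_erase.2 ⟨hz, Finset.mem_univ z⟩) (by simp)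
    rw [heq, hS', Matrix.diagonal_single] at he
    exact he
  have hunit : ∀ x y, Matrix.single x y (1 : Ω) ∈ S := by
    intro x y
    have hedge : ∀ x y, (∃ M ∈ S, M x y ≠ 0) → Matrix.single x y (1 : Ω) ∈ S := by
      rintro x y ⟨M, hM, hne⟩
      have h1 := S.smul_mem (S.mul_mem (S.mul_mem (hidem x) hM) (hidem y)) (M x y)⁻¹
      rw [Matrix.single_mul_mul_single] at h1
      simpa [Matrix.smul_single, hne] using h1
    induction hconn x y with
    | single h => exact hedge _ _ h
    | tail _ h ih =>
      have := S.mul_mem ih (hedge _ _ h)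
      simpa using this
  rw [eq_top_iff]
  intro M _
  rw [Matrix.matrix_eq_sum_single M]
  refine Subalgebra.sum_mem _ fun x _ => Subalgebra.sum_mem _ fun y _ => ?_
  have := S.smul_mem (hunit x y) (M x y)
  simpa [Matrix.smul_single] using this

end Digraph

/-- The adjoined field is algebraic over the subalgebra generated by S. -/
theorem trdeg_adjoin_le {k : Type w} {Ω : Type u} [Field k] [Field Ω] [Algebra k Ω] (S : Set Ω) :
    Algebra.trdeg k (IntermediateField.adjoin k S) ≤ Cardinal.mk S := by
  let s : Set (IntermediateField.adjoin k S) := {x | (x : Ω) ∈ S}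
  have halg : ∀ (x : Ω) (hx : x ∈ IntermediateField.adjoin k S),
      IsAlgebraic (Algebra.adjoin k s) (⟨x, hx⟩ : IntermediateField.adjoin k S) := by
    intro x hx
    induction hx using IntermediateField.adjoin_induction with
    | mem x hx =>
      exact isAlgebraic_algebraMap (R := Algebra.adjoin k s)
        (⟨⟨x, _⟩, Algebra.subset_adjoin hx⟩ : Algebra.adjoin k s)
    | algebraMap c =>
      exact isAlgebraic_algebraMap (R := Algebra.adjoin k s) (algebraMap k (Algebra.adjoin k s) c)
    | add x y _ _ hx hy => exact hx.add hy
    | inv x _ hx => exact hx.inv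
    | mul x y _ _ hx hy => exact hx.mul hy
  have : Algebra.IsAlgebraic (Algebra.adjoin k s) (IntermediateField.adjoin k S) :=
    ⟨fun x => halg x x.2⟩
  refine (Algebra.IsAlgebraic.trdeg_le_cardinalMk k s).trans ?_
  exact Cardinal.mk_le_of_injective (f := fun x : s => (⟨x.1.1, x.2⟩ : S)) fun x y h => by
    exact Subtype.ext (Subtype.ext (Subtype.mk.inj h))

/-! ### The upper bound -/

section Bound

theorem AlgEquiv.eq_of_apply_primitive_eq {K F : Type*} [Field K] [Field F] [Algebra K F] {φ : F}
    (hφ : IntermediateField.adjoin K {φ} = ⊤) {σ τ : F ≃ₐ[K] F} (h : σ φ = τ φ) : σ = τ := by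
  ext x
  have hx : x ∈ IntermediateField.adjoin K {φ} := hφ ▸ IntermediateField.mem_top
  induction hx using IntermediateField.adjoin_induction with
  | mem x hx => rw [Set.mem_singleton_iff.1 hx, h]
  | algebraMap c => simp
  | add x y _ _ hx hy => rw [map_add, map_add, hx, hy]
  | inv x _ hx => rw [map_inv₀, map_inv₀, hx]
  | mul x y _ _ hx hy => rw [map_mul, map_mul, hx, hy]

/-- Given an adapted splitting, projections onto the homogeneous components of `A`. -/
theorem exists_homogeneous_projection {K Ω A F X : Type*} [Field K] [Field Ω] [Algebra K Ω] [Ring A]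
    [Algebra K A] [Field F] [Algebra K F] [Fintype X] [DecidableEq X] [Algebra.IsAlgebraic K Ω]
    [FiniteDimensional K F] [Algebra.IsSeparable K F] (ρ : A →ₐ[K] Matrix X X Ω) (j : F →ₐ[K] A)
    (ι : F →ₐ[K] Ω) (π : X → (F ≃ₐ[K] F))
    (hj : ∀ f, ρ (j f) = Matrix.diagonal fun x => ι (π x f)) (g : F ≃ₐ[K] F) :
    ∃ P : A →ₗ[K] A, ∀ a x y, (π y = π x * g → ρ (P a) x y = ρ a x y) ∧
      (π y ≠ π x * g → ρ (P a) x y = 0) := by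
  obtain ⟨φ, hφ⟩ := Field.exists_primitive_element K F
  -- The component of degree g is the kernel of a ↦ a j(φ) − j(g φ) a for a primitive element φ.
  obtain ⟨P, hP⟩ := exists_projection ρ
    (LinearMap.mulRight K (j φ) - LinearMap.mulLeft K (j (g φ)))
    (fun x y => ι (π y φ) - ι (π x (g φ))) (by
      intro a x y
      simp [hj, Matrix.diagonal_mul, Matrix.mul_diagonal]
      ring)
  refine ⟨P, fun a x y => ⟨fun h => (hP a x y).1 ?_, fun h => (hP a x y).2 fun h0 => h ?_⟩⟩
  · rw [h, sub_eq_zero]; rfl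
  · exact AlgEquiv.eq_of_apply_primitive_eq hφ (ι.injective (sub_eq_zero.1 h0))

/-- Homogeneous elements in general position. -/
theorem exists_generic_homogeneous {K Ω A F X I : Type*} [Field K] [Field Ω] [Algebra K Ω] [Ring A]
    [Algebra K A] [Field F] [Algebra K F] [Fintype X] [DecidableEq X] [Finite I] [Nonempty I]
    [Algebra.IsAlgebraic K Ω] [Infinite K] [FiniteDimensional K A]
    [FiniteDimensional K F] [Algebra.IsSeparable K F] (ρ : A →ₐ[K] Matrix X X Ω)
    (hspan : Submodule.span Ω (Set.range ρ) = ⊤) (j : F →ₐ[K] A)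
    (ι : F →ₐ[K] Ω) (π : X → (F ≃ₐ[K] F))
    (hj : ∀ f, ρ (j f) = Matrix.diagonal fun x => ι (π x f)) (g : I → F ≃ₐ[K] F)
    (hsep : ∀ x y, x ≠ y → ∃ (a : I → Matrix X X Ω) (i i' : I) (p p' : ℕ),
      (∀ i x y, π y ≠ π x * g i → a i x y = 0) ∧
      (a i ^ p * a i' ^ p') x x ≠ (a i ^ p * a i' ^ p') y y) :
    ∃ a : I → A, (∀ i x y, ρ (a i) x y ≠ 0 ↔ π y = π x * g i) ∧
      ∀ x y, x ≠ y → ∃ (i i' : I) (p p' : ℕ),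
        ρ (a i ^ p * a i' ^ p') x x ≠ ρ (a i ^ p * a i' ^ p') y y := by
  classical
  have := Fintype.ofFinite I
  choose P hP using fun i => exists_homogeneous_projection ρ j ι π hj (g i)
  choose! a₀ i i' p p' ha₀ hne using hsep
  let G : I → Matrix X X (MvPolynomial (I × X × X) Ω) := fun i => Matrix.of fun x y =>
    if π y = π x * g i then MvPolynomial.X (i, x, y) else 0
  let W : X → X → Matrix X X (MvPolynomial (I × X × X) Ω) := fun x y =>
    G (i x y) ^ p x y * G (i' x y) ^ p' x y
  have hW : ∀ v x y z z', MvPolynomial.eval v (W x y z z') =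
      ((G (i x y)).map (MvPolynomial.eval v) ^ p x y *
        (G (i' x y)).map (MvPolynomial.eval v) ^ p' x y) z z' := by
    intro v x y z z'
    simp only [W, ← RingHom.mapMatrix_apply, ← map_pow, ← map_mul]
    rfl
  -- The first product makes all entries nonzero, the second makes the chosen words separate all
  -- pairs. Each factor of the second is nonzero at the matrices a₀ of its own pair, so no single
  -- choice has to serve all pairs.
  let f : MvPolynomial (I × X × X) Ω := (∏ z, MvPolynomial.X z) *
    ∏ z : X × X, if z.1 = z.2 then 1 else (W z.1 z.2 z.1 z.1 - W z.1 z.2 z.2 z.2)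
  have hf : f ≠ 0 := by
    refine mul_ne_zero (Finset.prod_ne_zero_iff.2 fun z _ => MvPolynomial.X_ne_zero z)
      (Finset.prod_ne_zero_iff.2 fun z _ => ?_)
    split_ifs with hz
    · exact one_ne_zero
    · intro h0
      have h1 := congrArg (MvPolynomial.eval fun t => a₀ z.1 z.2 t.1 t.2.1 t.2.2) h0
      have hG : ∀ i, (G i).map (MvPolynomial.eval fun t => a₀ z.1 z.2 t.1 t.2.1 t.2.2)
          = a₀ z.1 z.2 i := by
        intro i
        ext x y
        by_cases h : π y = π x * g i
        · simp [G, h]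
        · simp [G, h, ha₀ z.1 z.2 hz i x y h]
      rw [map_sub, map_zero, hW, hW, hG, hG] at h1
      exact hne z.1 z.2 hz (sub_eq_zero.1 h1)
  obtain ⟨α, hα⟩ := exists_eval_entries_ne_zero ρ hspan f hf
  rw [map_mul, map_prod, map_prod] at hα
  have hα1 := Finset.prod_ne_zero_iff.1 (left_ne_zero_of_mul hα)
  have hα2 := Finset.prod_ne_zero_iff.1 (right_ne_zero_of_mul hα)
  have hG : ∀ i, (G i).map (MvPolynomial.eval fun z => ρ (α z.1) z.2.1 z.2.2)
      = ρ (P i (α i)) := by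
    intro i
    ext x y
    by_cases h : π y = π x * g i
    · simp [G, h, (hP i (α i) x y).1 h]
    · simp [G, h, (hP i (α i) x y).2 h]
  refine ⟨fun i => P i (α i), fun i x y => ⟨fun h => ?_, fun h => ?_⟩, fun x y hxy =>
    ⟨i x y, i' x y, p x y, p' x y, ?_⟩⟩
  · by_contra hne
    exact h ((hP i (α i) x y).2 hne)
  · rw [(hP i (α i) x y).1 h]
    simpa using hα1 (i, x, y) (Finset.mem_univ _)
  · have := hα2 (x, y) (Finset.mem_univ _)
    rw [if_neg hxy, map_sub, hW, hW, hG, hG, sub_ne_zero] at this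
    simpa only [map_mul, map_pow] using this

theorem conjRep_diagonal_apply {K Ω A X : Type*} [Field K] [Field Ω] [Algebra K Ω] [Ring A]
    [Algebra K A] [Fintype X] [DecidableEq X] (ρ : A →ₐ[K] Matrix X X Ω) (t : X → Ω)
    (ht : ∀ x, t x ≠ 0) : ∃ P : (Matrix X X Ω)ˣ,
      ∀ a x y, conjRep ρ P a x y = (t x)⁻¹ * ρ a x y * t y := by
  refine ⟨⟨Matrix.diagonal t, Matrix.diagonal fun x => (t x)⁻¹, ?_, ?_⟩, fun a x y => ?_⟩
  · simp [Matrix.diagonal_mul_diagonal, ht]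
  · simp [Matrix.diagonal_mul_diagonal, ht]
  · rw [conjRep_apply]
    change (Matrix.diagonal (fun x => (t x)⁻¹) * ρ a * Matrix.diagonal t) x y = _
    rw [Matrix.mul_diagonal, Matrix.diagonal_mul]

/-- Homogeneous elements in general position define a field of small transcendence degree to which
the algebra descends. -/
theorem exists_descendsTo_of_generic {k : Type w} {K Ω : Type u} [Field k] [Field K] [Algebra k K]
    [Field Ω] [Algebra K Ω] [Algebra k Ω] [IsScalarTower k K Ω] [Algebra.IsAlgebraic K Ω]
    {A : Type v} [Ring A] [Algebra K A] [IsCSA K A] {X Q I : Type*} [Fintype X] [DecidableEq X]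
    [Nonempty X] [Group Q] [Fintype I] (ρ : A →ₐ[K] Matrix X X Ω)
    (hcard : finrank K A = Fintype.card X ^ 2) (π : X → Q) (g : I → Q) {m : ℕ}
    (hm' : ∀ q, Nat.card {x // π x = q} = m)
    (hconn : ∀ x y, Relation.TransGen (fun x y => ∃ i, π y = π x * g i) x y)
    (θ : A) (d : X → Ω) (hd : Function.Injective d) (hθ : ρ θ = Matrix.diagonal d) (a : I → A)
    (hedge : ∀ i x y, ρ (a i) x y ≠ 0 ↔ π y = π x * g i)
    (hword : ∀ x y, x ≠ y → ∃ (i i' : I) (p p' : ℕ),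
      ρ (a i ^ p * a i' ^ p') x x ≠ ρ (a i ^ p * a i' ^ p') y y) :
    ∃ (N : ℕ) (K₀ : IntermediateField k K),
      N + Fintype.card X = Fintype.card I * (Fintype.card X * m) + 1 ∧
      DescendsTo A K₀ ∧ Algebra.trdeg k K₀ ≤ N := by
  classical
  let x₀ : X := Classical.arbitrary X
  obtain ⟨p, N, hpR, hpN⟩ := exists_parent _ x₀ fun x => (hconn x x₀).to_reflTransGen
  have : Nonempty I := by
    obtain ⟨_, ⟨i, _⟩, _⟩ := Relation.TransGen.head'_iff.1 (hconn x₀ x₀)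
    exact ⟨i⟩
  choose! e he using hpR
  -- With these potentials, conjugation by diag t turns the entries on the tree edges (x, p x) into
  -- 1.
  obtain ⟨t, ht0, ht⟩ := exists_potential x₀ p N hpN (fun x => ρ (a (e x)) x (p x))
    fun x hx => (hedge _ _ _).2 (he x hx)
  obtain ⟨U, hU⟩ := conjRep_diagonal_apply ρ t ht0
  set ρ' := conjRep ρ U with hρ'
  let Γ : Finset (I × X × X) :=
    Finset.univ.filter fun z => π z.2.2 = π z.2.1 * g z.1
  let Tr : Finset (I × X × X) :=
    (Finset.univ.erase x₀).image fun x => (e x, x, p x)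
  let val : I × X × X → Ω := fun z => ρ' (a z.1) z.2.1 z.2.2
  obtain ⟨Ω₀, hΩ₀⟩ : ∃ Ω₀ : IntermediateField k Ω,
      Ω₀ = IntermediateField.adjoin k ((Γ \ Tr).image val : Finset Ω) := ⟨_, rfl⟩
  have hTr : Tr ⊆ Γ := by
    intro z hz
    obtain ⟨x, hx, rfl⟩ := Finset.mem_image.1 hz
    exact Finset.mem_filter.2 ⟨Finset.mem_univ _, he x (Finset.ne_of_mem_erase hx)⟩
  have hTrcard : Tr.card + 1 = Fintype.card X := by
    rw [Finset.card_image_of_injective _ (fun x y h => by simpa using congrArg (fun z => z.2.1) h),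
      Finset.card_erase_of_mem (Finset.mem_univ _), Finset.card_univ]
    exact Nat.sub_add_cancel Fintype.card_pos
  have hΓcard : Γ.card = Fintype.card I * (Fintype.card X * m) := by
    have h1 : ∀ q, ∑ y, (if π y = q then 1 else 0) = m := fun q => by
      rw [← hm' q, Nat.card_eq_fintype_card, Fintype.card_subtype, Finset.card_filter]
    simp only [Γ, Finset.card_filter, Fintype.sum_prod_type, h1]
    simp
  have hmem : ∀ i x y, ρ' (a i) x y ∈ Ω₀ := by
    intro i x y
    by_cases hΓ : (i, x, y) ∈ Γ
    · by_cases hT : (i, x, y) ∈ Tr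
      · obtain ⟨z, hz, hzeq⟩ := Finset.mem_image.1 hT
        obtain ⟨rfl, rfl, rfl⟩ : e z = i ∧ z = x ∧ p z = y := by simpa using hzeq
        have hz0 := Finset.ne_of_mem_erase hz
        have hne : ρ (a (e z)) z (p z) ≠ 0 := (hedge _ _ _).2 (he z hz0)
        have : ρ' (a (e z)) z (p z) = 1 := by
          rw [hU, ht z hz0]
          rw [mul_assoc, inv_mul_cancel₀ (mul_ne_zero hne (ht0 (p z)))]
        rw [this]
        exact one_mem _
      · have h1 : val (i, x, y) ∈ (Γ \ Tr).image val :=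
          Finset.mem_image.2 ⟨(i, x, y), Finset.mem_sdiff.2 ⟨hΓ, hT⟩, rfl⟩
        rw [← Finset.mem_coe] at h1
        have h2 := IntermediateField.subset_adjoin k _ h1
        rw [hΩ₀]
        exact h2
    · have : ρ (a i) x y = 0 := by
        by_contra h
        exact hΓ (Finset.mem_filter.2 ⟨Finset.mem_univ _, (hedge i x y).1 h⟩)
      rw [hU, this, mul_zero, zero_mul]
      exact zero_mem _
  let A₀ := entrySubalgebra ρ' Ω₀
  have haA₀ : ∀ i, a i ∈ A₀ := fun i => hmem i
  -- D takes the diagonal part, so it maps A₀ to itself even though θ need not lie in A₀.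
  obtain ⟨D, hD⟩ := exists_projection ρ (LinearMap.mulLeft K θ - LinearMap.mulRight K θ)
    (fun x y => d x - d y) (by
      intro a x y
      simp [hθ, Matrix.diagonal_mul, Matrix.mul_diagonal]
      ring)
  have hDdiag : ∀ b, ρ' (D b) = Matrix.diagonal fun x => ρ' b x x := by
    intro b
    ext x y
    by_cases hxy : x = y
    · subst hxy
      rw [Matrix.diagonal_apply_eq, hU, hU, (hD b x x).1 (sub_self _)]
    · rw [Matrix.diagonal_apply_ne _ hxy, hU,
        (hD b x y).2 (sub_ne_zero.2 (hd.ne hxy)), mul_zero, zero_mul]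
  have hDA₀ : ∀ b ∈ A₀, D b ∈ A₀ := by
    intro b hb x y
    rw [hDdiag, Matrix.diagonal_apply]
    split_ifs
    · exact hb x x
    · exact zero_mem _
  have hρ'xx : ∀ b x, ρ' b x x = ρ b x x := fun b x => by
    rw [hU, mul_right_comm, inv_mul_cancel₀ (ht0 x), one_mul]
  let S : Subalgebra Ω (Matrix (X) (X) Ω) :=
    Algebra.adjoin Ω (A₀.toSubmonoid.map (ρ' : A →* Matrix (X) (X) Ω))
  have hS : ∀ b ∈ A₀, ρ' b ∈ S := fun b hb => Algebra.subset_adjoin ⟨b, hb, rfl⟩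
  have hStop : S = ⊤ := by
    refine subalgebra_eq_top_of_separates S (fun x y hxy => ?_) (fun x y => ?_)
    · obtain ⟨i, i', p, p', hne⟩ := hword x y hxy
      have hw : a i ^ p * a i' ^ p' ∈ A₀ :=
        A₀.mul_mem (A₀.pow_mem (haA₀ i) _) (A₀.pow_mem (haA₀ i') _)
      have := hS _ (hDA₀ _ hw)
      rw [hDdiag] at this
      refine ⟨_, this, ?_⟩
      simpa only [hρ'xx] using hne
    · refine Relation.TransGen.mono ?_ _ _ (hconn x y)
      rintro u v ⟨i, hi⟩
      refine ⟨ρ' (a i), hS _ (haA₀ i), ?_⟩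
      rw [hU]
      exact mul_ne_zero (mul_ne_zero (inv_ne_zero (ht0 u)) ((hedge i u v).2 hi)) (ht0 v)
  have hspan' : Submodule.span Ω (ρ' '' {a | ∀ x y, ρ' a x y ∈ Ω₀}) = ⊤ := by
    have h1 := Algebra.adjoin_eq_span Ω (SetLike.coe
      (A₀.toSubmonoid.map (ρ' : A →* Matrix (X) (X) Ω)))
    rw [Submonoid.closure_eq] at h1
    change Subalgebra.toSubmodule S = _ at h1
    rw [hStop, Algebra.top_toSubmodule] at h1
    exact h1.symm
  refine ⟨(Γ \ Tr).card, Ω₀.comap (IsScalarTower.toAlgHom k K Ω), ?_,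
    descendsTo_comap ρ' hcard Ω₀ hspan', ?_⟩
  · have := Finset.card_sdiff_add_card_eq_card hTr
    omega
  · let emb : Ω₀.comap (IsScalarTower.toAlgHom k K Ω) →ₐ[k] Ω₀ :=
      ((IsScalarTower.toAlgHom k K Ω).comp (IntermediateField.val _)).codRestrict Ω₀.toSubalgebra
        fun x => x.2
    have h1 : Algebra.trdeg k (Ω₀.comap (IsScalarTower.toAlgHom k K Ω)) ≤ Algebra.trdeg k Ω₀ :=
      trdeg_le_of_injective emb (RingHom.injective emb.toRingHom)
    refine h1.trans ?_
    rw [hΩ₀]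
    refine (trdeg_adjoin_le _).trans ?_
    refine (Cardinal.mk_coe_finset (s := (Γ \ Tr).image val)).le.trans ?_
    exact_mod_cast Finset.card_image_le

/-- The part of the bound for infinite K: here m is the common fibre size of π, and N counts the
edges off the spanning tree. -/
theorem exists_descendsTo_trdeg_le {k : Type w} {K : Type u} [Field k] [Field K] [Algebra k K]
    {A : Type v} [Ring A] [Algebra K A] [IsCSA K A] [Infinite K] {F : Type*} [Field F]
    [Algebra K F] [FiniteDimensional K F] [IsGalois K F] (j : F →ₐ[K] A) {n r : ℕ}
    (hn : finrank K A = n ^ 2) (hr : 1 ≤ r) (hgen : GeneratedBy (F ≃ₐ[K] F) r)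
    (hr2 : finrank K F = n → 2 ≤ r) :
    ∃ (m N : ℕ) (K₀ : IntermediateField k K), m * finrank K F = n ∧ N + n = r * (n * m) + 1 ∧
      DescendsTo A K₀ ∧ Algebra.trdeg k K₀ ≤ N := by
  classical
  have : FiniteDimensional K A := IsCSA.finite
  have : IsSimpleRing A := IsCSA.simple K
  have : Algebra.IsCentral K A := IsCSA.central
  obtain ⟨g, hg⟩ := hgen
  let Ω := AlgebraicClosure K
  obtain ⟨n', hn'0, ρ, ι, π, θ, d, hcard, hspan, hd, hθ, hj⟩ :=
    exists_adapted_splitting (Ω := Ω) j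
  obtain rfl : n' = n := Nat.pow_left_injective (n := 2) (by norm_num) (hcard.symm.trans hn)
  have hcard' : finrank K A = Fintype.card (Fin n') ^ 2 := by rw [hcard, Fintype.card_fin]
  have hfib := card_fiber_mul_finrank ρ hcard' hspan j ι π hj
  rw [Fintype.card_fin] at hfib
  set m := Nat.card {x // π x = 1} with hm
  have hdpos : 0 < finrank K F := finrank_pos
  have hm' : ∀ q, Nat.card {x // π x = q} = m := fun q =>
    Nat.eq_of_mul_eq_mul_right hdpos ((hfib q).trans (hfib 1).symm)
  have hnpos : 0 < n' := Nat.pos_of_ne_zero hn'0.out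
  have hmpos : 0 < m := by
    rcases Nat.eq_zero_or_pos m with h | h
    · have := hfib 1
      rw [← hm, h] at this
      omega
    · exact h
  have hπ : Function.Surjective π := fun q => by
    have : 0 < Nat.card {x // π x = q} := by rw [hm']; exact hmpos
    obtain ⟨⟨x, hx⟩⟩ := (Nat.card_pos_iff.1 this).1
    exact ⟨x, hx⟩
  have hsep : ∀ x y, x ≠ y → ∃ (a : Fin r → Matrix (Fin n') (Fin n') Ω) (i i' : Fin r) (p p' : ℕ),
      (∀ i x y, π y ≠ π x * g i → a i x y = 0) ∧
      (a i ^ p * a i' ^ p') x x ≠ (a i ^ p * a i' ^ p') y y := by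
    intro x y hxy
    -- Fibres with several points leave room for a section avoiding y; if m = 1, then π is bijective
    -- and a second generator is needed.
    rcases Nat.lt_or_ge 1 m with hm1 | hm1
    · obtain ⟨a, p, ha, hne⟩ := exists_separating_power (Ω := Ω) π (g ⟨0, hr⟩) (fun q x => by
        have h1 : 1 < Nat.card {x // π x = q} := by rwa [hm']
        have := Finite.one_lt_card_iff_nontrivial.1 h1
        by_contra! hcon
        obtain ⟨⟨u, hu⟩, ⟨v, hv⟩, huv⟩ := exists_pair_ne {x // π x = q}
        exact huv (Subtype.ext ((hcon u hu).trans (hcon v hv).symm))) hxy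
      refine ⟨fun i => if i = ⟨0, hr⟩ then a else 0, ⟨0, hr⟩, ⟨0, hr⟩, p, 0, fun i x y h => ?_, ?_⟩
      · by_cases hi : i = ⟨0, hr⟩
        · subst hi; simpa using ha x y h
        · simp [hi]
      · simpa using hne
    · have hm1 : m = 1 := by omega
      have hr2' : 2 ≤ r := hr2 (by have := hfib 1; rwa [← hm, hm1, one_mul] at this)
      have hinj : Function.Injective π := fun u v huv => by
        have h1 : Nat.card {x // π x = π v} ≤ 1 := by rw [hm', hm1]
        have := Finite.card_le_one_iff_subsingleton.1 h1
        exact congrArg Subtype.val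
          (Subsingleton.elim (⟨u, huv⟩ : {x // π x = π v}) ⟨v, rfl⟩)
      exact exists_separating_word π ⟨hinj, hπ⟩ g
        (i₁ := ⟨0, hr⟩) (i₂ := ⟨1, hr2'⟩) (by simp) hxy
  have : Nonempty (Fin r) := ⟨⟨0, hr⟩⟩
  obtain ⟨a, hedge, hword⟩ := exists_generic_homogeneous ρ hspan j ι π hj g hsep
  have : Nonempty (Fin n') := ⟨⟨0, hnpos⟩⟩
  obtain ⟨N, K₀, hN, hdesc, htr⟩ := exists_descendsTo_of_generic (k := k) ρ hcard' π g hm'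
    (transGen_of_closure_eq_top π hπ g hg) θ d hd hθ a hedge hword
  rw [Fintype.card_fin, Fintype.card_fin] at hN
  exact ⟨m, N, K₀, hfib 1, hN, hdesc, htr⟩

end Bound

/-! ### Finite base fields and the deduction of (a) and (b) -/

section Conclusion

theorem exists_essentialDim_eq {k : Type w} {K : Type u} [Field k] [Field K] [Algebra k K]
    {A : Type v} [Ring A] [Algebra K A] {K₀ : IntermediateField k K} (h : DescendsTo A K₀) {N : ℕ}
    (hN : Algebra.trdeg k K₀ ≤ N) : ∃ d : ℕ, essentialDim k K A = d ∧ d ≤ N := by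
  have h0 : essentialDim k K A ≤ Algebra.trdeg k K₀ := csInf_le' ⟨K₀, h, rfl⟩
  have h1 : essentialDim k K A ≤ N := h0.trans hN
  obtain ⟨d, hd⟩ := Cardinal.lt_aleph0.1 (h1.trans_lt (Cardinal.natCast_lt_aleph0))
  exact ⟨d, hd, by rw [hd] at h1; exact_mod_cast h1⟩

/-- A finite K is algebraic over k, and A descends to K itself. -/
theorem essentialDim_eq_zero_of_finite (k : Type w) (K : Type u) [Field k] [Field K] [Algebra k K]
    (A : Type v) [Ring A] [Algebra K A] [IsCSA K A] [Finite K] : essentialDim k K A = 0 := by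
  have : FiniteDimensional K A := IsCSA.finite
  have : IsSimpleRing A := IsCSA.simple K
  have : Algebra.IsCentral K A := IsCSA.central
  obtain ⟨n, _, ρ, hcard, hspan⟩ := exists_splitting K (AlgebraicClosure K) A
  have hdesc := descendsTo_comap (k := k) ρ (by rw [hcard, Fintype.card_fin]) ⊤ (by
    simpa using hspan)
  have : Algebra.IsAlgebraic k K := inferInstance
  have htr := trdeg_eq_zero (R := k) (A :=
    (⊤ : IntermediateField k (AlgebraicClosure K)).comap
      (IsScalarTower.toAlgHom k K (AlgebraicClosure K)))
  obtain ⟨d, hd, hd0⟩ := exists_essentialDim_eq hdesc (N := 0) (by rw [htr]; simp)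
  rw [hd, Nat.le_zero.1 hd0, Nat.cast_zero]

theorem exists_essentialDim_le_of_galois {k : Type w} {K : Type u} [Field k] [Field K] [Algebra k K]
    {A : Type v} [Ring A] [Algebra K A] [IsCSA K A] (n r : ℕ) (F : Type*) [Field F] [Algebra K F]
    [IsGalois K F] (hn : finrank K A = n ^ 2) (hF : Nonempty (F →ₐ[K] A)) (hr : 1 ≤ r)
    (hgen : GeneratedBy (F ≃ₐ[K] F) r) (hr2 : finrank K F = n → 2 ≤ r) :
    ∃ d : ℕ, essentialDim k K A = d ∧
      (d : ℚ) ≤ r * ((n : ℚ) ^ 2 / finrank K F) - n + 1 := by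
  have : FiniteDimensional K A := IsCSA.finite
  have : IsSimpleRing A := IsCSA.simple K
  obtain ⟨j⟩ := hF
  have : FiniteDimensional K F :=
    FiniteDimensional.of_injective j.toLinearMap (RingHom.injective j.toRingHom)
  have hdpos : (0 : ℚ) < finrank K F := by exact_mod_cast finrank_pos (R := K) (M := F)
  rcases finite_or_infinite K with hK | hK
  · refine ⟨0, by rw [essentialDim_eq_zero_of_finite, Nat.cast_zero], ?_⟩
    have : Algebra.IsCentral K A := IsCSA.central
    obtain ⟨m, hm⟩ := finrank_dvd_of_algHom j hn
    have hm' : (n : ℚ) = finrank K F * m := by exact_mod_cast hm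
    have h1 : (n : ℚ) ^ 2 / finrank K F = n * m := by
      rw [div_eq_iff hdpos.ne', sq, mul_assoc, mul_comm (m : ℚ), ← hm']
    -- For finite K it remains to see that the bound is nonnegative, which uses that [F:K] divides
    -- n.
    have hnm : n ≤ r * (n * m) := by
      rcases Nat.eq_zero_or_pos m with rfl | hmpos
      · simp [hm]
      · calc n = 1 * (n * 1) := by ring
          _ ≤ r * (n * m) := Nat.mul_le_mul hr (Nat.mul_le_mul_left _ hmpos)
    have hnm' : (n : ℚ) ≤ r * (n * m) := by exact_mod_cast hnm
    rw [h1, Nat.cast_zero]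
    linarith
  · obtain ⟨m, N, K₀, hm, hN, hdesc, htr⟩ :=
      exists_descendsTo_trdeg_le (k := k) j hn hr hgen hr2
    obtain ⟨d, hd, hdN⟩ := exists_essentialDim_eq hdesc htr
    refine ⟨d, hd, ?_⟩
    have hm' : (n : ℚ) = m * finrank K F := by exact_mod_cast hm.symm
    have hN' : (N : ℚ) + n = r * (n * m) + 1 := by exact_mod_cast hN
    have hdN' : (d : ℚ) ≤ N := by exact_mod_cast hdN
    have : (n : ℚ) ^ 2 / finrank K F = n * m := by
      rw [div_eq_iff hdpos.ne', sq, mul_assoc, ← hm']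
    rw [this]
    linarith

theorem GeneratedBy.of_mulEquiv {G H : Type*} [Group G] [Group H] (e : G ≃* H) {r : ℕ}
    (h : GeneratedBy G r) : GeneratedBy H r := by
  obtain ⟨g, hg⟩ := h
  refine ⟨e ∘ g, ?_⟩
  have := congrArg (Subgroup.map e.toMonoidHom) hg
  rw [MonoidHom.map_closure, ← MonoidHom.range_eq_map, MonoidHom.range_eq_top.2 e.surjective,
    ← Set.range_comp] at this
  exact this

/-- The fixed field F of N lies in L, hence embeds in A, and has Galois group G/N. If [F:K] = [L:K],
then H = N is normal, so H equals its trivial core; this is the case in which r ≥ 2 is required. -/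
theorem exists_essentialDim_le_of_isCrossedProduct {k : Type w} {K : Type u} [Field k] [Field K]
    [Algebra k K] {A : Type v} [Ring A] [Algebra K A] [IsCSA K A] (r : ℕ) (G : Type*) [Group G]
    (H N : Subgroup G) [N.Normal] (hA : IsCrossedProduct H K A) (hHN : H ≤ N) (hr : 1 ≤ r)
    (hgen : GeneratedBy (G ⧸ N) r) (hr2 : H ≠ ⊥ ∨ 2 ≤ r) :
    ∃ d : ℕ, essentialDim k K A = d ∧
      (d : ℚ) ≤ r * H.index * H.relIndex N - H.index + 1 := by
  obtain ⟨-, hcore, E, _, _, e, L, _, _, hL, hfin, ⟨i⟩⟩ := hA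
  let N' : Subgroup (E ≃ₐ[K] E) := N.comap e.toMonoidHom
  have : N'.Normal := inferInstanceAs (N.comap e.toMonoidHom).Normal
  let F := IntermediateField.fixedField N'
  have hLN : L.fixingSubgroup ≤ N' := by
    rw [← Subgroup.map_le_iff_le_comap, hL]
    exact hHN
  have hFL : F ≤ L := by
    rw [← IsGalois.fixedField_fixingSubgroup L]
    exact IntermediateField.fixedField_antitone hLN
  have hLrank : finrank K L = H.index := by
    rw [IntermediateField.finrank_eq_fixingSubgroup_index, ← hL,
      Subgroup.index_map_of_bijective e.bijective]
  have hFrank : finrank K F = N.index := by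
    rw [IntermediateField.finrank_eq_fixingSubgroup_index,
      IntermediateField.fixingSubgroup_fixedField, Subgroup.index_comap_of_surjective _ e.surjective]
  have hmul : H.relIndex N * N.index = H.index := Subgroup.relIndex_mul_index hHN
  have hpos : 0 < H.index := hLrank ▸ finrank_pos
  have hNpos : 0 < N.index := hFrank ▸ finrank_pos
  have hgenF : GeneratedBy (F ≃ₐ[K] F) r :=
    (hgen.of_mulEquiv (QuotientGroup.congr N' N e
      (Subgroup.map_comap_eq_self_of_surjective e.surjective N)).symm).of_mulEquiv
      (IsGalois.normalAutEquivQuotient N')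
  obtain ⟨d, hd, hle⟩ := exists_essentialDim_le_of_galois (k := k) H.index r F
    (by rw [hfin, hLrank]) ⟨i.comp (IntermediateField.inclusion hFL)⟩ hr hgenF (by
      intro h
      refine hr2.resolve_left fun hne => hne ?_
      rw [hFrank] at h
      have h1 : H.relIndex N = 1 := Nat.eq_of_mul_eq_mul_right hNpos (by rw [hmul, one_mul, h])
      have hHN' : H = N := le_antisymm hHN (Subgroup.relIndex_eq_one.1 h1)
      subst hHN'
      rw [← hcore, Subgroup.normalCore_eq_self])
  refine ⟨d, hd, hle.trans_eq ?_⟩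
  have hmul' : (H.index : ℚ) = H.relIndex N * N.index := by exact_mod_cast hmul.symm
  have hNpos' : (N.index : ℚ) ≠ 0 := by exact_mod_cast hNpos.ne'
  rw [hFrank, sq, mul_div_assoc, show (H.index : ℚ) / N.index = H.relIndex N by
    rw [hmul', mul_div_cancel_right₀ _ hNpos'], mul_assoc]

end Conclusion

theorem theorem1p2 {k : Type w} {K : Type u} [Field k] [Field K] [Algebra k K]
    {A : Type v} [Ring A] [Algebra K A] [IsCSA K A] :
    (∀ (n r : ℕ) (F : Type*) [Field F] [Algebra K F] [IsGalois K F],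
      finrank K A = n ^ 2 →
      Nonempty (F →ₐ[K] A) →
      1 ≤ r → GeneratedBy (F ≃ₐ[K] F) r →
      (finrank K F = n → 2 ≤ r) →
      ∃ d : ℕ, essentialDim k K A = d ∧
        (d : ℚ) ≤ r * ((n : ℚ) ^ 2 / finrank K F) - n + 1) ∧
    (∀ (r : ℕ) (G : Type*) [Group G] (H N : Subgroup G) [N.Normal],
      IsCrossedProduct H K A →
      H ≤ N →
      1 ≤ r → GeneratedBy (G ⧸ N) r →
      (H ≠ ⊥ ∨ 2 ≤ r) →
      ∃ d : ℕ, essentialDim k K A = d ∧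
        (d : ℚ) ≤ r * H.index * H.relIndex N - H.index + 1) := by
  exact ⟨fun n r F _ _ _ hn hF hr hgen hr2 =>
      exists_essentialDim_le_of_galois n r F hn hF hr hgen hr2,
    fun r G _ H N _ hA hHN hr hgen hr2 =>
      exists_essentialDim_le_of_isCrossedProduct r G H N hA hHN hr hgen hr2⟩
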